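/- A crossed module of topological groups $(H,G)$ consists of continuous homomorphisms $t\colon G\to H$ and $\alpha\colon H\to \mathrm{Aut}(G)$ (the map $(h,g)\mapsto\alpha(h)(g)$ being continuous) with $t(\alpha(h)(g))=h\,t(g)\,h^{-1}$ and $\alpha(t(g))(k)=gkg^{-1}$. Put $G_1=\ker t$, which is central in $G$, and assume that $G\to t(G)$ (where $t(G)\subset H$ has the subspace topology) and $H\to H/t(G)$ admit local sections. Let $M$ be a topological space. An $(H,G)$ bibundle on $M$ is a right principal (locally trivial) $G$-bundle $P\to M$ with a continuous structure map $\psi\colon P\to H$ such that $\psi(pg)=\psi(p)t(g)$; isomorphisms of bibundles are isomorphisms of principal bundles over $M$ that commute with the structure maps. $G$ acts on $P$ from the left by $gp=p\,\alpha(\psi(p))^{-1}(g)$. The trivial bibundle is $M\times G$ with $\psi(m,g)=t(g)$. The product is $P\otimes Q=(P\times_M Q)/G$, where $(p,q)g=(pg,g^{-1}q)$, with right action $(p\otimes q)g=p\otimes qg$ and structure map $\psi(p\otimes q)=\psi(p)\psi(q)$. The type $\mathrm{Type}(P)\colon M\to H/t(G)$ sends $m$ to $[\psi(p)]$, for any $p$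 over $m$. For a principal $G_1$-bundle $Q$ the extension is the bibundle $\iota(Q)=Q\times_{G_1}G$ with $\psi([q,g])=t(g)$. Write $\pi_0\mathrm{Bun}_{G_1}(M)$ and $\pi_0\mathrm{Bibun}_{(H,G)}(M)$ for the sets of isomorphism classes of principal $G_1$-bundles and of $(H,G)$ bibundles, $\mathrm{Map}(M,H/t(G))$ for the group of continuous maps, and $H^2(M,G_1)$ for the Čech cohomology of the sheaf of continuous $G_1$-valued functions. For $\phi\in\mathrm{Map}(M,H/t(G))$, the lifting bundle gerbe of $\phi$ is the $G_1$ bundle gerbe $(P_\phi,\phi^*H)$ over $M$, where $P_\phi\to\phi^*H\times_M\phi^*H$ is the pullback of the $G_1$-bundle $G\to t(G)$ along $((m,h),(m,h'))\mapsto h^{-1}h'$, with multiplication induced by that of $G$. The class of a bundle gerbe $(P,Y)$ over $M$ is the class in $H^2(M,G_1)$ of a cocycle $(\gamma_{xyz})$ with $\sigma_{xy}\sigma_{yz}=\sigma_{xz}\gamma_{xyz}$, for an open cover $(U_x)$ of $M$, sections $s_x\colon U_x\to Y$ and sections $\sigma_{xy}$ of $(s_x,s_y)^*P$ over $U_x\cap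 U_y$. Then: 1. $\pi_0\mathrm{Bun}_{G_1}(M)$ and $\pi_0\mathrm{Bibun}_{(H,G)}(M)$ are groups under the product of bundles, with the classes of the trivial bundles as units; $\iota$ and $\mathrm{Type}$ induce group homomorphisms, and $$1\to \pi_0\mathrm{Bun}_{G_1}(M)\xrightarrow{\ \iota\ }\pi_0\mathrm{Bibun}_{(H,G)}(M)\xrightarrow{\mathrm{Type}}\mathrm{Map}(M,H/t(G))$$ is an exact sequence of groups. 2. A principal $G_1$-bundle $Q$ is trivial if and only if $\iota(Q)$ is a trivial $(H,G)$ bibundle, and a bibundle $P$ has trivial type if and only if $P\cong\iota(Q)$ for some principal $G_1$-bundle $Q$. 3. A map $\phi\in\mathrm{Map}(M,H/t(G))$ is the type of a bibundle if and only if the lifting bundle gerbe of $\phi$ has trivial class. 4. If $M$ is paracompact and Hausdorff, the lifting bundle gerbe of every $\phi$ has exactly one class $\epsilon(\phi)\in H^2(M,G_1)$, so that the sequence $$1\to \pi_0\mathrm{Bun}_{G_1}(M)\xrightarrow{\ \iota\ }\pi_0\mathrm{Bibun}_{(H,G)}(M)\xrightarrow{\mathrm{Type}}\mathrm{Map}(M,H/t(G))\xrightarrow{\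 \epsilon\ }H^2(M,G_1)$$ is exact: the image of $\mathrm{Type}$ is $\epsilon^{-1}(1)$. Moreover $\epsilon$ is a crossed homomorphism: with $H^2(M,G_1)$ written multiplicatively, $\epsilon(\phi\phi')=(\phi'^{-1}\cdot\epsilon(\phi))\,\epsilon(\phi')$ for the action of $\mathrm{Map}(M,H/t(G))$ on $H^2(M,G_1)$ induced by $\alpha$. -/

import Mathlib

open Topology

universe u

set_option linter.unusedSectionVars false

/-- A map `f : X → Y` admits local sections: every point of `Y` has an open neighbourhood
over which `f` has a continuous section. -/
def HasLocalSections {X Y : Type*} [TopologicalSpace X] [TopologicalSpace Y] (f : X → Y) : Prop :=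
  ∀ y : Y, ∃ U : Set Y, IsOpen U ∧ y ∈ U ∧ ∃ s : U → X, Continuous s ∧ ∀ z : U, f (s z) = z

/-! ### Crossed modules of topological groups -/

section Crossed

variable {H G : Type u} [Group H] [TopologicalSpace H] [IsTopologicalGroup H]
  [Group G] [TopologicalSpace G] [IsTopologicalGroup G]

/-- A crossed module `G → H → Aut(G)` of topological groups. -/
structure CrossedModule (H G : Type u) [Group H] [TopologicalSpace H]
    [Group G] [TopologicalSpace G] where
  t : G →* H
  α : H →* MulAut G
  continuous_t : Continuous t
  continuous_α : Continuous fun x : H × G => α x.1 x.2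
  t_α : ∀ h g, t (α h g) = h * t g * h⁻¹
  α_t : ∀ g k, α (t g) k = g * k * g⁻¹

namespace CrossedModule

variable (K : CrossedModule H G)

/-- The group `G₁ = ker t`, with the subspace topology. -/
abbrev G₁ : Subgroup G := K.t.ker

instance range_normal : K.t.range.Normal where
  conj_mem := by
    rintro _ ⟨g, rfl⟩ h
    exact ⟨K.α h g, K.t_α h g⟩

/-- The group `H / t(G)`, with the quotient topology. -/
abbrev Out : Type u := H ⧸ K.t.range

theorem G₁_central (a : K.G₁) (g : G) : (a : G) * g = g * a := by
  have h := K.α_t a g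
  rw [show K.t a = 1 from a.2, map_one, MulAut.one_apply] at h
  rw [eq_mul_inv_iff_mul_eq] at h
  exact h.symm

instance commGroupG₁ : CommGroup K.G₁ :=
  { (inferInstance : Group K.G₁) with
    mul_comm := fun a b => Subtype.ext (K.G₁_central a b) }

theorem α_mem_G₁ (h : H) (a : K.G₁) : K.α h a ∈ K.G₁ := by
  rw [MonoidHom.mem_ker, K.t_α, show K.t a = 1 from a.2]; simp

/-- The action of `H` on `G₁` obtained by restricting `α`. -/
def αG₁ : H →* Monoid.End K.G₁ where
  toFun h :=
    { toFun := fun a => ⟨K.α h a, K.α_mem_G₁ h a⟩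
      map_one' := by ext; simp
      map_mul' := fun a b => by ext; simp }
  map_one' := MonoidHom.ext fun a => Subtype.ext (by
    change K.α 1 a = a
    rw [map_one, MulAut.one_apply])
  map_mul' h k := MonoidHom.ext fun a => Subtype.ext (by
    change K.α (h * k) a = K.α h (K.α k a)
    rw [map_mul, MulAut.mul_apply])

/-- The action of `H / t(G)` on `G₁` induced by `α`. -/
def outAct : K.Out →* Monoid.End K.G₁ :=
  QuotientGroup.lift K.t.range K.αG₁ (by
    rintro _ ⟨g, rfl⟩
    refine MonoidHom.ext fun a => Subtype.ext ?_
    change K.α (K.t g) a = a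
    rw [K.α_t, ← K.G₁_central a g]; simp)

theorem continuous_outAct : Continuous fun x : K.Out × K.G₁ => K.outAct x.1 x.2 := by
  have hq : IsOpenQuotientMap (Prod.map (QuotientGroup.mk : H → K.Out) (id : K.G₁ → K.G₁)) :=
    QuotientGroup.isOpenQuotientMap_mk.prodMap IsOpenQuotientMap.id
  rw [← hq.isQuotientMap.continuous_iff.symm]
  refine Continuous.subtype_mk (f := fun x : H × K.G₁ => K.α x.1 x.2) ?_ _
  exact K.continuous_α.comp
    (continuous_fst.prodMk (continuous_subtype_val.comp continuous_snd))

end CrossedModule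

end Crossed

/-! ### Principal bundles -/

/-- A (right) principal `G`-bundle over `M`. -/
structure PrincipalBundle (G M : Type u) [Group G] [TopologicalSpace G]
    [TopologicalSpace M] where
  total : Type u
  [top : TopologicalSpace total]
  proj : total → M
  continuous_proj : Continuous proj
  act : total → G → total
  continuous_act : Continuous fun x : total × G => act x.1 x.2
  act_one : ∀ p, act p 1 = p
  act_mul : ∀ p g k, act p (g * k) = act (act p g) k
  proj_act : ∀ p g, proj (act p g) = proj p
  locally_trivial : ∀ m : M, ∃ U : Set M, IsOpen U ∧ m ∈ U ∧
    ∃ e : (U × G) ≃ₜ (proj ⁻¹' U), (∀ x, proj (e x) = x.1) ∧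
      ∀ x g k, (e (x, g * k) : total) = act (e (x, g)) k

attribute [instance] PrincipalBundle.top

/-- A continuous section over `U`, with a continuous coordinate relative to it, gives a local
trivialisation. -/
theorem locally_trivial_of_section {G M E : Type u} [Group G] [TopologicalSpace G]
    [TopologicalSpace M] [TopologicalSpace E] {proj : E → M} (hproj : Continuous proj)
    {act : E → G → E} (hact : Continuous fun x : E × G => act x.1 x.2)
    (act_mul : ∀ p g k, act p (g * k) = act (act p g) k)
    (proj_act : ∀ p g, proj (act p g) = proj p)
    {U : Set M} (s : U → E) (hs : Continuous s) (hsp : ∀ x : U, proj (s x) = x)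
    (d : proj ⁻¹' U → G) (hd : Continuous d)
    (h1 : ∀ p : proj ⁻¹' U, act (s ⟨proj p, p.2⟩) (d p) = p)
    (h2 : ∀ (p : proj ⁻¹' U) (x : U) (g : G), (p : E) = act (s x) g → d p = g) :
    ∃ e : (U × G) ≃ₜ (proj ⁻¹' U), (∀ x, proj (e x) = x.1) ∧
      ∀ x g k, (e (x, g * k) : E) = act (e (x, g)) k := by
  have hm : ∀ x : U × G, proj (act (s x.1) x.2) = x.1 := fun x => by rw [proj_act, hsp]
  refine ⟨{ toFun := fun x => ⟨act (s x.1) x.2, by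
              change proj _ ∈ U; rw [hm]; exact x.1.2⟩
            invFun := fun p => (⟨proj p, p.2⟩, d p)
            left_inv := ?_
            right_inv := ?_
            continuous_toFun := ?_
            continuous_invFun := ?_ }, hm, fun x g k => act_mul _ _ _⟩
  · rintro ⟨x, g⟩
    refine Prod.ext (Subtype.ext (hm (x, g))) (h2 _ x g rfl)
  · intro p
    exact Subtype.ext (h1 p)
  · exact Continuous.subtype_mk
      (hact.comp ((hs.comp continuous_fst).prodMk continuous_snd)) _
  · exact (Continuous.subtype_mk (hproj.comp continuous_subtype_val) _).prodMk hd

namespace PrincipalBundle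

section

variable {G M : Type u} [Group G] [TopologicalSpace G] [TopologicalSpace M]

/-- Isomorphism of principal bundles over the identity of `M`. -/
def IsIso (P Q : PrincipalBundle G M) : Prop :=
  ∃ f : P.total ≃ₜ Q.total, (∀ p, Q.proj (f p) = P.proj p) ∧
    ∀ p g, f (P.act p g) = Q.act (f p) g

/-- The setoid of isomorphic principal bundles. -/
def isoSetoid (G M : Type u) [Group G] [TopologicalSpace G] [TopologicalSpace M] :
    Setoid (PrincipalBundle G M) where
  r := IsIso
  iseqv :=
    { refl := fun P => ⟨Homeomorph.refl _, fun _ => rfl, fun _ _ => rfl⟩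
      symm := by
        rintro P Q ⟨f, h1, h2⟩
        refine ⟨f.symm, fun q => ?_, fun q g => ?_⟩
        · rw [← h1, f.apply_symm_apply]
        · rw [f.symm_apply_eq, h2, f.apply_symm_apply]
      trans := by
        rintro P Q R ⟨f, h1, h2⟩ ⟨k, h3, h4⟩
        refine ⟨f.trans k, fun p => ?_, fun p g => ?_⟩
        · simp [h3, h1]
        · simp [h2, h4] }

/-- The trivial principal bundle `M × G`. -/
def trivial (G M : Type u) [Group G] [TopologicalSpace G] [IsTopologicalGroup G]
    [TopologicalSpace M] : PrincipalBundle G M where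
  total := M × G
  proj := Prod.fst
  continuous_proj := continuous_fst
  act p g := (p.1, p.2 * g)
  continuous_act := by fun_prop
  act_one p := by simp
  act_mul p g k := by simp [mul_assoc]
  proj_act p g := rfl
  locally_trivial m := by
    refine ⟨Set.univ, isOpen_univ, Set.mem_univ _, ?_⟩
    refine locally_trivial_of_section (E := M × G) (G := G)
      (act := fun p g => (p.1, p.2 * g)) continuous_fst (by fun_prop)
      (fun p g k => by simp [mul_assoc]) (fun p g => rfl)
      (fun x : (Set.univ : Set M) => ((x : M), (1 : G))) (by fun_prop) (fun x => rfl)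
      (fun p => p.1.2) (by fun_prop) ?_ ?_
    · rintro ⟨⟨a, b⟩, h⟩; simp
    · rintro ⟨⟨a, b⟩, h⟩ x g hp
      simpa using congrArg Prod.snd hp

theorem proj_surjective (P : PrincipalBundle G M) : Function.Surjective P.proj := by
  intro m
  obtain ⟨U, -, hm, e, he, -⟩ := P.locally_trivial m
  exact ⟨e (⟨m, hm⟩, 1), he _⟩

/-- A local section and the continuous, equivariant coordinate relative to it. -/
theorem exists_section (P : PrincipalBundle G M) (m : M) :
    ∃ U : Set M, IsOpen U ∧ m ∈ U ∧ ∃ (s : U → P.total) (d : P.proj ⁻¹' U → G),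
      Continuous s ∧ Continuous d ∧ (∀ x, P.proj (s x) = x) ∧
      (∀ p : P.proj ⁻¹' U, P.act (s ⟨P.proj p, p.2⟩) (d p) = p) ∧
      (∀ (p q : P.proj ⁻¹' U) (g : G), (q : P.total) = P.act p g → d q = d p * g) ∧
      ∀ (p : P.proj ⁻¹' U) (x : U), (p : P.total) = s x → d p = 1 := by
  obtain ⟨U, hU, hm, e, he, hea⟩ := P.locally_trivial m
  have hfst : ∀ p : P.proj ⁻¹' U, ((e.symm p).1 : M) = P.proj p := fun p => by
    rw [← he, e.apply_symm_apply]
  refine ⟨U, hU, hm, fun x => e (x, 1), fun p => (e.symm p).2, by fun_prop, by fun_prop,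
    fun x => he _, fun p => ?_, fun p q g hq => ?_, fun p x hp => ?_⟩
  · have h : (⟨P.proj p, p.2⟩ : U) = (e.symm p).1 := Subtype.ext (hfst p).symm
    rw [h, ← hea, one_mul]
    exact congrArg Subtype.val (e.apply_symm_apply p)
  · have h : q = e ((e.symm p).1, (e.symm p).2 * g) := by
      refine Subtype.ext ?_
      rw [hea, Prod.mk.eta, e.apply_symm_apply, hq]
    change (e.symm q).2 = _
    rw [h, e.symm_apply_apply]
  · have h : p = e (x, 1) := Subtype.ext hp
    change (e.symm p).2 = _
    rw [h, e.symm_apply_apply]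

end

section Contracted

variable {A G M : Type u} [Group A] [TopologicalSpace A] [IsTopologicalGroup A]
  [Group G] [TopologicalSpace G] [TopologicalSpace M]

/-- A continuous fibrewise left action of `A` on a principal `G`-bundle that commutes with the
right action of `G`. -/
structure LeftAction (A : Type u) [Group A] [TopologicalSpace A] (Q : PrincipalBundle G M) where
  lact : A → Q.total → Q.total
  continuous_lact : Continuous fun x : A × Q.total => lact x.1 x.2
  one_lact : ∀ q, lact 1 q = q
  mul_lact : ∀ a b q, lact (a * b) q = lact a (lact b q)
  proj_lact : ∀ a q, Q.proj (lact a q) = Q.proj q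
  lact_act : ∀ a q g, lact a (Q.act q g) = Q.act (lact a q) g

variable (P : PrincipalBundle A M) (Q : PrincipalBundle G M) (L : LeftAction A Q)

/-- The fibre product `P ×_M Q`. -/
abbrev FibreProduct : Type u := {x : P.total × Q.total // P.proj x.1 = Q.proj x.2}

/-- The map `(p, q) ↦ (p a, a⁻¹ q)` of `P ×_M Q`. -/
def shift (a : A) (x : FibreProduct P Q) : FibreProduct P Q :=
  ⟨(P.act x.1.1 a, L.lact a⁻¹ x.1.2), by rw [P.proj_act, L.proj_lact]; exact x.2⟩

theorem shift_one (x : FibreProduct P Q) : shift P Q L 1 x = x := by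
  refine Subtype.ext (Prod.ext ?_ ?_) <;> simp [shift, P.act_one, L.one_lact]

theorem shift_mul (a b : A) (x : FibreProduct P Q) :
    shift P Q L (a * b) x = shift P Q L b (shift P Q L a x) := by
  refine Subtype.ext (Prod.ext ?_ ?_) <;> simp [shift, P.act_mul, L.mul_lact]

theorem continuous_shift (a : A) : Continuous (shift P Q L a) := by
  have h1 := P.continuous_act
  have h2 := L.continuous_lact
  refine Continuous.subtype_mk (Continuous.prodMk ?_ ?_) _
  · exact h1.comp ((continuous_fst.comp continuous_subtype_val).prodMk continuous_const)
  · exact h2.comp (continuous_const.prodMk (continuous_snd.comp continuous_subtype_val))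

/-- The orbit relation of the action `(p, q) a = (p a, a⁻¹ q)` on `P ×_M Q`. -/
def shiftSetoid : Setoid (FibreProduct P Q) where
  r x y := ∃ a, y = shift P Q L a x
  iseqv :=
    { refl := fun x => ⟨1, (shift_one P Q L x).symm⟩
      symm := by
        rintro x _ ⟨a, rfl⟩
        exact ⟨a⁻¹, by rw [← shift_mul, mul_inv_cancel, shift_one]⟩
      trans := by
        rintro x _ _ ⟨a, rfl⟩ ⟨b, rfl⟩
        exact ⟨a * b, by rw [shift_mul]⟩ }

theorem isOpenQuotientMap_mk :
    IsOpenQuotientMap (Quotient.mk (shiftSetoid P Q L)) := by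
  refine ⟨Quotient.mk_surjective, continuous_quotient_mk', fun V hV => ?_⟩
  refine (isQuotientMap_quotient_mk' (s := shiftSetoid P Q L)).isOpen_preimage.1 ?_
  have : (Quotient.mk (shiftSetoid P Q L)) ⁻¹' ((Quotient.mk (shiftSetoid P Q L)) '' V)
      = ⋃ a, (shift P Q L a) ⁻¹' V := by
    ext x
    simp only [Set.mem_preimage, Set.mem_image, Set.mem_iUnion]
    constructor
    · rintro ⟨y, hy, hxy⟩
      obtain ⟨a, rfl⟩ := (Quotient.exact hxy.symm : (shiftSetoid P Q L).r x y)
      exact ⟨a, hy⟩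
    · rintro ⟨a, ha⟩
      exact ⟨_, ha, (Quotient.sound (s := shiftSetoid P Q L) ⟨a, rfl⟩).symm⟩
  change IsOpen ((Quotient.mk (shiftSetoid P Q L)) ⁻¹' _)
  rw [this]
  exact isOpen_iUnion fun a => hV.preimage (continuous_shift P Q L a)

/-- The contracted product `P ×_A Q = (P ×_M Q) / A`, where `(p, q) a = (p a, a⁻¹ q)`, with
right action `[p, q] g = [p, q g]`. -/
def contracted : PrincipalBundle G M :=
  let S := shiftSetoid P Q L
  have hmk := isOpenQuotientMap_mk P Q L
  let pr : Quotient S → M := Quotient.lift (fun x => P.proj x.1.1) (by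
    rintro x _ ⟨a, rfl⟩; exact (P.proj_act _ _).symm)
  let ac : Quotient S → G → Quotient S := fun z g =>
    Quotient.map (sa := S) (sb := S)
      (fun x : FibreProduct P Q => (⟨(x.1.1, Q.act x.1.2 g), by
        rw [Q.proj_act]; exact x.2⟩ : FibreProduct P Q)) (by
      rintro x _ ⟨a, rfl⟩
      exact ⟨a, Subtype.ext (Prod.ext rfl (L.lact_act _ _ _).symm)⟩) z
  have hpr : Continuous pr := by
    refine hmk.isQuotientMap.continuous_iff.2 ?_
    exact P.continuous_proj.comp (continuous_fst.comp continuous_subtype_val)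
  have hac : Continuous fun x : Quotient S × G => ac x.1 x.2 := by
    refine (hmk.prodMap IsOpenQuotientMap.id).isQuotientMap.continuous_iff.2 ?_
    refine hmk.continuous.comp (Continuous.subtype_mk (Continuous.prodMk ?_ ?_) _)
    · exact continuous_fst.comp (continuous_subtype_val.comp continuous_fst)
    · exact Q.continuous_act.comp
        ((continuous_snd.comp (continuous_subtype_val.comp continuous_fst)).prodMk continuous_snd)
  have ac_mul : ∀ z g k, ac z (g * k) = ac (ac z g) k := by
    intro z g k
    induction z using Quotient.inductionOn with
    | h x => exact congrArg (Quotient.mk S)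
              (Subtype.ext (Prod.ext rfl (Q.act_mul _ _ _)))
  have pr_ac : ∀ z g, pr (ac z g) = pr z := by
    intro z g
    induction z using Quotient.inductionOn with
    | h x => rfl
  { total := Quotient S
    proj := pr
    continuous_proj := hpr
    act := ac
    continuous_act := hac
    act_one := by
      intro z
      induction z using Quotient.inductionOn with
      | h x => exact congrArg (Quotient.mk S)
                (Subtype.ext (Prod.ext rfl (Q.act_one _)))
    act_mul := ac_mul
    proj_act := pr_ac
    locally_trivial := by
      intro m
      obtain ⟨U₁, hU₁, hm₁, s₁, d₁, hs₁, hd₁, hp₁, hr₁, ha₁, ho₁⟩ := P.exists_section m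
      obtain ⟨U₂, hU₂, hm₂, s₂, d₂, hs₂, hd₂, hp₂, hr₂, ha₂, ho₂⟩ := Q.exists_section m
      refine ⟨U₁ ∩ U₂, hU₁.inter hU₂, ⟨hm₁, hm₂⟩, ?_⟩
      have mem₁ : ∀ x : FibreProduct P Q, pr (Quotient.mk S x) ∈ U₁ ∩ U₂ →
          P.proj x.1.1 ∈ U₁ := fun x hx => hx.1
      have mem₂ : ∀ x : FibreProduct P Q, pr (Quotient.mk S x) ∈ U₁ ∩ U₂ → ∀ a,
          Q.proj (L.lact a x.1.2) ∈ U₂ := fun x hx a => by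
        rw [L.proj_lact, ← x.2]; exact hx.2
      let D : {x : FibreProduct P Q // pr (Quotient.mk S x) ∈ U₁ ∩ U₂} → G := fun x =>
        d₂ ⟨L.lact (d₁ ⟨x.1.1.1, mem₁ x.1 x.2⟩) x.1.1.2, mem₂ x.1 x.2 _⟩
      have hD : Continuous D := by
        refine hd₂.comp (Continuous.subtype_mk (L.continuous_lact.comp
          (Continuous.prodMk (hd₁.comp (Continuous.subtype_mk ?_ _)) ?_)) _)
        · exact continuous_fst.comp (continuous_subtype_val.comp continuous_subtype_val)
        · exact continuous_snd.comp (continuous_subtype_val.comp continuous_subtype_val)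
      have hDeq : ∀ x y, (shiftSetoid P Q L).r x.1 y.1 → D x = D y := by
        rintro ⟨x, hx⟩ ⟨_, hy⟩ ⟨a, rfl⟩
        refine congrArg d₂ (Subtype.ext ?_)
        have e : d₁ ⟨(shift P Q L a x).1.1, mem₁ _ hy⟩ = d₁ ⟨x.1.1, mem₁ _ hx⟩ * a :=
          ha₁ _ _ a rfl
        change L.lact (d₁ ⟨x.1.1, mem₁ _ hx⟩) x.1.2
          = L.lact (d₁ ⟨(shift P Q L a x).1.1, mem₁ _ hy⟩) (L.lact a⁻¹ x.1.2)
        rw [e, ← L.mul_lact, mul_inv_cancel_right]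
      have hout : ∀ p : pr ⁻¹' (U₁ ∩ U₂),
          pr (Quotient.mk S p.1.out) ∈ U₁ ∩ U₂ := fun p => by
        rw [Quotient.out_eq]; exact p.2
      let d : pr ⁻¹' (U₁ ∩ U₂) → G := fun p => D ⟨p.1.out, hout p⟩
      have hdmk : ∀ (x : FibreProduct P Q) (hx : pr (Quotient.mk S x) ∈ U₁ ∩ U₂),
          d ⟨Quotient.mk S x, hx⟩ = D ⟨x, hx⟩ := fun x hx =>
        hDeq _ _ (Quotient.exact (Quotient.out_eq (Quotient.mk S x)))
      have hd : Continuous d := by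
        have hq : IsQuotientMap (Set.restrictPreimage (pr ⁻¹' (U₁ ∩ U₂)) (Quotient.mk S)) :=
          hmk.isQuotientMap.restrictPreimage_isOpen ((hU₁.inter hU₂).preimage hpr)
        refine hq.continuous_iff.2 ?_
        have : d ∘ Set.restrictPreimage (pr ⁻¹' (U₁ ∩ U₂)) (Quotient.mk S)
            = fun x => D ⟨x.1, x.2⟩ := by
          funext x; exact hdmk x.1 x.2
        rw [this]
        exact hD
      let σ : ↥(U₁ ∩ U₂) → FibreProduct P Q := fun x =>
        ⟨(s₁ ⟨x.1, x.2.1⟩, s₂ ⟨x.1, x.2.2⟩), by rw [hp₁, hp₂]⟩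
      refine locally_trivial_of_section hpr hac ac_mul pr_ac
        (fun x => Quotient.mk S (σ x)) ?_ (fun x => hp₁ _) d hd ?_ ?_
      · refine hmk.continuous.comp (Continuous.subtype_mk (Continuous.prodMk ?_ ?_) _)
        · exact hs₁.comp (Continuous.subtype_mk continuous_subtype_val _)
        · exact hs₂.comp (Continuous.subtype_mk continuous_subtype_val _)
      · rintro ⟨z, hz⟩
        induction z using Quotient.inductionOn with
        | h x =>
          rw [hdmk x hz]
          refine Quotient.sound (s := S) ⟨d₁ ⟨x.1.1, mem₁ x hz⟩, ?_⟩
          refine Subtype.ext (Prod.ext ?_ ?_)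
          · exact (hr₁ ⟨x.1.1, mem₁ x hz⟩).symm
          · have h := hr₂ ⟨L.lact (d₁ ⟨x.1.1, mem₁ x hz⟩) x.1.2, mem₂ x hz _⟩
            have h' : ∀ u : U₂, (u : M) = P.proj x.1.1 →
                Q.act (s₂ u) (D ⟨x, hz⟩) = L.lact (d₁ ⟨x.1.1, mem₁ x hz⟩) x.1.2 := by
              intro u hu
              refine Eq.trans ?_ h
              have e : u = ⟨Q.proj (L.lact (d₁ ⟨x.1.1, mem₁ x hz⟩) x.1.2), mem₂ x hz _⟩ :=
                Subtype.ext (hu.trans (x.2.trans (L.proj_lact _ _).symm))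
              rw [e]
            change x.1.2 = L.lact _ (Q.act (s₂ ⟨P.proj x.1.1, hz.2⟩) (D ⟨x, hz⟩))
            rw [h' _ rfl, ← L.mul_lact, inv_mul_cancel, L.one_lact]
      · rintro ⟨z, hz⟩ x g hp
        have hp' : z = Quotient.mk S
            (⟨((σ x).1.1, Q.act (σ x).1.2 g), by
              rw [Q.proj_act]; exact (σ x).2⟩ : FibreProduct P Q) := hp
        subst hp'
        rw [hdmk]
        have e1 : ∀ h, d₁ ⟨(σ x).1.1, h⟩ = 1 := fun h => ho₁ _ ⟨x.1, x.2.1⟩ rfl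
        have hmem : Q.proj (s₂ ⟨x.1, x.2.2⟩) ∈ U₂ := by rw [hp₂]; exact x.2.2
        have e2 : d₂ ⟨s₂ ⟨x.1, x.2.2⟩, hmem⟩ = 1 := ho₂ _ _ rfl
        refine (ha₂ ⟨s₂ ⟨x.1, x.2.2⟩, hmem⟩ _ g ?_).trans (by rw [e2, one_mul])
        change L.lact (d₁ ⟨(σ x).1.1, _⟩) (Q.act (σ x).1.2 g) = _
        rw [e1, L.one_lact] }

end Contracted

end PrincipalBundle

/-! ### Bibundles -/

section Bibundles

variable {H G M : Type u} [Group H] [TopologicalSpace H] [IsTopologicalGroup H]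
  [Group G] [TopologicalSpace G] [IsTopologicalGroup G] [TopologicalSpace M]

/-- An `(H, G)` bibundle over `M`: a principal `G`-bundle with a continuous structure map
`ψ = str` to `H` such that `ψ(p g) = ψ(p) t(g)`. -/
structure Bibundle (K : CrossedModule H G) (M : Type u) [TopologicalSpace M]
    extends PrincipalBundle G M where
  str : total → H
  continuous_str : Continuous str
  str_act : ∀ p g, str (act p g) = str p * K.t g

namespace Bibundle

variable {K : CrossedModule H G}

/-- Isomorphism of bibundles over the identity of `M`. -/
def IsIso (P Q : Bibundle K M) : Prop :=
  ∃ f : P.total ≃ₜ Q.total, (∀ p, Q.proj (f p) = P.proj p) ∧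
    (∀ p g, f (P.act p g) = Q.act (f p) g) ∧ ∀ p, Q.str (f p) = P.str p

/-- The setoid of isomorphic bibundles. -/
def isoSetoid (K : CrossedModule H G) (M : Type u) [TopologicalSpace M] :
    Setoid (Bibundle K M) where
  r := IsIso
  iseqv :=
    { refl := fun P => ⟨Homeomorph.refl _, fun _ => rfl, fun _ _ => rfl, fun _ => rfl⟩
      symm := by
        rintro P Q ⟨f, h1, h2, h3⟩
        refine ⟨f.symm, fun q => ?_, fun q g => ?_, fun q => ?_⟩
        · rw [← h1, f.apply_symm_apply]
        · rw [f.symm_apply_eq, h2, f.apply_symm_apply]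
        · rw [← h3, f.apply_symm_apply]
      trans := by
        rintro P Q R ⟨f, h1, h2, h5⟩ ⟨k, h3, h4, h6⟩
        refine ⟨f.trans k, fun p => ?_, fun p g => ?_, fun p => ?_⟩
        · simp [h3, h1]
        · simp [h2, h4]
        · simp [h5, h6] }

/-- The trivial bibundle: `M × G` with structure map `(m, g) ↦ t(g)`. -/
def trivial (K : CrossedModule H G) (M : Type u) [TopologicalSpace M] : Bibundle K M where
  toPrincipalBundle := PrincipalBundle.trivial G M
  str p := K.t (show M × G from p).2
  continuous_str := K.continuous_t.comp continuous_snd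
  str_act _ _ := map_mul K.t _ _

theorem exists_eq_act (P : PrincipalBundle G M) {p q : P.total} (h : P.proj p = P.proj q) :
    ∃ g, q = P.act p g := by
  obtain ⟨U, -, hm, s, d, -, -, -, hr, -, -⟩ := P.exists_section (P.proj p)
  have h1 := hr ⟨p, hm⟩
  have hq : P.proj q ∈ U := h ▸ hm
  have h2 := hr ⟨q, hq⟩
  refine ⟨(d ⟨p, hm⟩)⁻¹ * d ⟨q, hq⟩, ?_⟩
  have h3 : (⟨P.proj p, hm⟩ : U) = ⟨P.proj q, hq⟩ := Subtype.ext h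
  rw [← h3] at h2
  calc q = P.act (s ⟨P.proj p, hm⟩) (d ⟨q, hq⟩) := h2.symm
    _ = P.act (P.act (s ⟨P.proj p, hm⟩) (d ⟨p, hm⟩)) ((d ⟨p, hm⟩)⁻¹ * d ⟨q, hq⟩) := by
      rw [← P.act_mul, mul_inv_cancel_left]
    _ = _ := by rw [h1]

/-- The value at `m` of the type map of `P`: the class `[ψ(p)]` for any `p` over `m`. -/
noncomputable def typeAt (P : Bibundle K M) (m : M) : K.Out :=
  QuotientGroup.mk (P.str (P.proj_surjective m).choose)

theorem typeAt_proj (P : Bibundle K M) (p : P.total) :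
    P.typeAt (P.proj p) = QuotientGroup.mk (P.str p) := by
  obtain ⟨g, hg⟩ := exists_eq_act P.toPrincipalBundle
    (P.proj_surjective (P.proj p)).choose_spec
  refine QuotientGroup.eq.2 ⟨g, ?_⟩
  have h := congrArg P.str hg
  rw [P.str_act] at h
  rw [eq_inv_mul_iff_mul_eq]
  exact h.symm

/-- The type map `M → H / t(G)` of a bibundle. -/
noncomputable def typeMap (P : Bibundle K M) : C(M, K.Out) where
  toFun := P.typeAt
  continuous_toFun := by
    refine continuous_iff_continuousAt.2 fun m => ?_
    obtain ⟨U, hU, hm, s, -, hs, -, hp, -⟩ := P.exists_section m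
    have h : ContinuousOn P.typeAt U := by
      rw [continuousOn_iff_continuous_domRestrict]
      have : U.domRestrict P.typeAt = fun x => (QuotientGroup.mk (P.str (s x)) : K.Out) := by
        funext x
        rw [← P.typeAt_proj, hp]; rfl
      rw [this]
      exact QuotientGroup.continuous_mk.comp (P.continuous_str.comp hs)
    exact h.continuousAt (hU.mem_nhds hm)

/-- The left action `g p = p (α(ψ(p))⁻¹(g))` of `G` on a bibundle. -/
def leftAction (P : Bibundle K M) : PrincipalBundle.LeftAction G P.toPrincipalBundle where
  lact g p := P.act p (K.α (P.str p)⁻¹ g)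
  continuous_lact := by
    refine P.continuous_act.comp (continuous_snd.prodMk (K.continuous_α.comp
      (((P.continuous_str.comp continuous_snd).inv).prodMk continuous_fst)))
  one_lact q := by rw [map_one, P.act_one]
  mul_lact a b q := by
    rw [← P.act_mul, P.str_act, K.t_α, show P.str q * ((P.str q)⁻¹ * K.t b * (P.str q)⁻¹⁻¹)
      = K.t b * P.str q by group, mul_inv_rev, map_mul K.α, MulAut.mul_apply, ← map_inv K.t,
      K.α_t, ← map_mul]
    congr 2
    group
  proj_lact a q := P.proj_act _ _
  lact_act a q g := by
    rw [← P.act_mul, ← P.act_mul, P.str_act, mul_inv_rev, map_mul K.α, MulAut.mul_apply,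
      ← map_inv K.t, K.α_t]
    congr 1
    group

/-- The product `P ⊗ Q = (P ×_M Q) / G`, where `(p, q) g = (p g, g⁻¹ q)`, with right action
`(p ⊗ q) g = p ⊗ q g` and structure map `ψ(p ⊗ q) = ψ(p) ψ(q)`. -/
def tensor (P Q : Bibundle K M) : Bibundle K M where
  toPrincipalBundle := PrincipalBundle.contracted P.toPrincipalBundle Q.toPrincipalBundle
    Q.leftAction
  str := Quotient.lift (fun x => P.str x.1.1 * Q.str x.1.2) (by
    rintro x _ ⟨a, rfl⟩
    change _ = P.str (P.act _ a) * Q.str (Q.act _ (K.α _ a⁻¹))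
    rw [P.str_act, Q.str_act, K.t_α, map_inv]
    group)
  continuous_str := by
    refine (PrincipalBundle.isOpenQuotientMap_mk _ _ _).isQuotientMap.continuous_iff.2 ?_
    exact (P.continuous_str.comp (continuous_fst.comp continuous_subtype_val)).mul
      (Q.continuous_str.comp (continuous_snd.comp continuous_subtype_val))
  str_act z g := by
    induction z using Quotient.inductionOn with
    | h x =>
      change P.str x.1.1 * Q.str (Q.act x.1.2 g) = P.str x.1.1 * Q.str x.1.2 * K.t g
      rw [Q.str_act, mul_assoc]

end Bibundle

namespace PrincipalBundle

/-- The trivial left action `a q = q a` of an abelian structure group. -/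
def abelianLeftAction {A : Type u} [CommGroup A] [TopologicalSpace A]
    (Q : PrincipalBundle A M) : LeftAction A Q where
  lact a q := Q.act q a
  continuous_lact := Q.continuous_act.comp continuous_swap
  one_lact := Q.act_one
  mul_lact a b q := by rw [mul_comm, Q.act_mul]
  proj_lact a q := Q.proj_act _ _
  lact_act a q g := by rw [← Q.act_mul, ← Q.act_mul, mul_comm]

/-- The product `Q ⊗ R = (Q ×_M R) / A`, where `(q, r) a = (q a, r a⁻¹)`, of principal bundles
with abelian structure group `A`. -/
def tensor {A : Type u} [CommGroup A] [TopologicalSpace A] [IsTopologicalGroup A]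
    (Q R : PrincipalBundle A M) : PrincipalBundle A M :=
  contracted Q R R.abelianLeftAction

end PrincipalBundle

namespace CrossedModule

variable (K : CrossedModule H G)

/-- Left multiplication of `G₁` on the second factor of the trivial bundle `M × G`. -/
def leftMul (M : Type u) [TopologicalSpace M] :
    PrincipalBundle.LeftAction K.G₁ (PrincipalBundle.trivial G M) where
  lact a p := ((p : M × G).1, (a : G) * (p : M × G).2)
  continuous_lact := by
    have h : Continuous fun x : K.G₁ × (M × G) => (x.2.1, (x.1 : G) * x.2.2) := by fun_prop
    exact h
  one_lact p := Prod.ext rfl (one_mul _)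
  mul_lact a b p := Prod.ext rfl (mul_assoc _ _ _)
  proj_lact a p := rfl
  lact_act a p g := Prod.ext rfl (mul_assoc _ _ _).symm

/-- The extension `ι(Q) = Q ×_{G₁} G` of a `G₁`-bundle `Q` to an `(H, G)` bibundle, where
`(q, g) a = (q a, a⁻¹ g)`, with right action `[q, g] k = [q, g k]` and structure map
`ψ([q, g]) = t(g)`. The product `Q × G` is written as the fibre product of `Q` and `M × G`
over `M`. -/
def extend (Q : PrincipalBundle K.G₁ M) : Bibundle K M where
  toPrincipalBundle := PrincipalBundle.contracted Q (PrincipalBundle.trivial G M) (K.leftMul M)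
  str := Quotient.lift (fun x => K.t (x.1.2 : M × G).2) (by
    rintro x _ ⟨a, rfl⟩
    change _ = K.t (((a⁻¹ : K.G₁) : G) * (x.1.2 : M × G).2)
    rw [map_mul, show K.t ((a⁻¹ : K.G₁) : G) = 1 from (a⁻¹).2, one_mul])
  continuous_str := by
    refine (PrincipalBundle.isOpenQuotientMap_mk _ _ _).isQuotientMap.continuous_iff.2 ?_
    exact K.continuous_t.comp
      (continuous_snd.comp (continuous_snd.comp continuous_subtype_val))
  str_act z g := by
    induction z using Quotient.inductionOn with
    | h x => exact map_mul K.t _ _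

end CrossedModule

/-- `π₀ Bun_A(M)`: isomorphism classes of principal `A`-bundles over `M`. -/
abbrev Bun₀ (A M : Type u) [Group A] [TopologicalSpace A] [TopologicalSpace M] : Type (u + 1) :=
  Quotient (PrincipalBundle.isoSetoid A M)

/-- `π₀ Bibun_{(H,G)}(M)`: isomorphism classes of `(H, G)` bibundles over `M`. -/
abbrev Bibun₀ (K : CrossedModule H G) (M : Type u) [TopologicalSpace M] : Type (u + 1) :=
  Quotient (Bibundle.isoSetoid K M)

/-- The class of a principal bundle in `π₀ Bun_A(M)`. -/
abbrev PrincipalBundle.cls {A : Type u} [Group A] [TopologicalSpace A]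
    (Q : PrincipalBundle A M) : Bun₀ A M :=
  Quotient.mk (PrincipalBundle.isoSetoid A M) Q

/-- The class of a bibundle in `π₀ Bibun_{(H,G)}(M)`. -/
abbrev Bibundle.cls {K : CrossedModule H G} (P : Bibundle K M) : Bibun₀ K M :=
  Quotient.mk (Bibundle.isoSetoid K M) P

end Bibundles

/-! ### Čech cohomology in degree two

Čech cohomology of the sheaf of continuous `A`-valued functions on `M`, computed with the open
covers `(U x)_{x : M}` such that `x ∈ U x`; these are cofinal among all open covers, and the
direct limit over them is formed along the inclusions `V x ⊆ U x`. Cochains are functions on all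
of `M` of which only the restrictions to the intersections of the sets of some cover matter. -/

namespace Cech

/-- An open cover of `M` by a neighbourhood `U x` of each point `x`. -/
def IsPointedCover {M : Type u} [TopologicalSpace M] (U : M → Set M) : Prop :=
  ∀ x, IsOpen (U x) ∧ x ∈ U x

theorem IsPointedCover.inter {M : Type u} [TopologicalSpace M] {U V : M → Set M}
    (hU : IsPointedCover U) (hV : IsPointedCover V) : IsPointedCover fun x => U x ∩ V x :=
  fun x => ⟨(hU x).1.inter (hV x).1, (hU x).2, (hV x).2⟩

theorem isPointedCover_univ (M : Type u) [TopologicalSpace M] :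
    IsPointedCover fun _ : M => (Set.univ : Set M) :=
  fun _ => ⟨isOpen_univ, Set.mem_univ _⟩

variable (M A : Type u) [TopologicalSpace M] [CommGroup A] [TopologicalSpace A]
  [IsTopologicalGroup A]

/-- Čech 2-cocycles `c_{xyz} : U_x ∩ U_y ∩ U_z → A`. -/
def cocycles : Subgroup (M → M → M → M → A) where
  carrier := {c | ∃ U : M → Set M, IsPointedCover U ∧
    (∀ x y z, ContinuousOn (c x y z) (U x ∩ U y ∩ U z)) ∧
    ∀ w x y z m, m ∈ U w → m ∈ U x → m ∈ U y → m ∈ U z →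
      c x y z m * (c w y z m)⁻¹ * c w x z m * (c w x y m)⁻¹ = 1}
  one_mem' := ⟨_, isPointedCover_univ M, fun _ _ _ => continuousOn_const, by simp⟩
  mul_mem' := by
    rintro c d ⟨U, hU, hc, hc'⟩ ⟨V, hV, hd, hd'⟩
    refine ⟨_, hU.inter hV, fun x y z => ?_, fun w x y z m hw hx hy hz => ?_⟩
    · exact ((hc x y z).mono fun m hm => ⟨⟨hm.1.1.1, hm.1.2.1⟩, hm.2.1⟩).mul
        ((hd x y z).mono fun m hm => ⟨⟨hm.1.1.2, hm.1.2.2⟩, hm.2.2⟩)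
    · have h := hc' w x y z m hw.1 hx.1 hy.1 hz.1
      have h' := hd' w x y z m hw.2 hx.2 hy.2 hz.2
      calc _ = (c x y z m * (c w y z m)⁻¹ * c w x z m * (c w x y m)⁻¹) *
            (d x y z m * (d w y z m)⁻¹ * d w x z m * (d w x y m)⁻¹) := by
              simp only [Pi.mul_apply, mul_inv_rev]; ac_rfl
        _ = 1 := by rw [h, h', one_mul]
  inv_mem' := by
    rintro c ⟨U, hU, hc, hc'⟩
    refine ⟨U, hU, fun x y z => (hc x y z).inv, fun w x y z m hw hx hy hz => ?_⟩
    have h := hc' w x y z m hw hx hy hz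
    calc _ = (c x y z m * (c w y z m)⁻¹ * c w x z m * (c w x y m)⁻¹)⁻¹ := by
              simp only [Pi.inv_apply, mul_inv_rev, inv_inv]; ac_rfl
      _ = 1 := by rw [h, inv_one]

/-- Čech 2-coboundaries `c_{xyz} = b_{yz} b_{xz}⁻¹ b_{xy}`. -/
def coboundaries : Subgroup (M → M → M → M → A) where
  carrier := {c | ∃ U : M → Set M, IsPointedCover U ∧ ∃ b : M → M → M → A,
    (∀ x y, ContinuousOn (b x y) (U x ∩ U y)) ∧
    ∀ x y z m, m ∈ U x → m ∈ U y → m ∈ U z →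
      c x y z m = b y z m * (b x z m)⁻¹ * b x y m}
  one_mem' := ⟨_, isPointedCover_univ M, 1, fun _ _ => continuousOn_const, by simp⟩
  mul_mem' := by
    rintro c d ⟨U, hU, a, ha, hc⟩ ⟨V, hV, b, hb, hd⟩
    refine ⟨_, hU.inter hV, a * b, fun x y => ?_, fun x y z m hx hy hz => ?_⟩
    · exact ((ha x y).mono fun m hm => ⟨hm.1.1, hm.2.1⟩).mul
        ((hb x y).mono fun m hm => ⟨hm.1.2, hm.2.2⟩)
    · simp only [Pi.mul_apply, hc x y z m hx.1 hy.1 hz.1, hd x y z m hx.2 hy.2 hz.2, mul_inv_rev]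
      ac_rfl
  inv_mem' := by
    rintro c ⟨U, hU, a, ha, hc⟩
    refine ⟨U, hU, a⁻¹, fun x y => (ha x y).inv, fun x y z m hx hy hz => ?_⟩
    simp only [Pi.inv_apply, hc x y z m hx hy hz, mul_inv_rev, inv_inv]
    ac_rfl

/-- The Čech cohomology group `H²(M, A)` (written multiplicatively). -/
abbrev H2 : Type u := cocycles M A ⧸ (coboundaries M A).subgroupOf (cocycles M A)

/-- The class of a cocycle in `H²(M, A)`. -/
abbrev H2.mk {M A : Type u} [TopologicalSpace M] [CommGroup A] [TopologicalSpace A]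
    [IsTopologicalGroup A] (c : cocycles M A) : H2 M A :=
  QuotientGroup.mk c

/-- The endomorphism of `H²(M, A)` induced by a continuous family `β_m` of endomorphisms
of `A`, given on cocycles by `(β c)_{xyz}(m) = β_m(c_{xyz}(m))`. -/
def H2.map {M A : Type u} [TopologicalSpace M] [CommGroup A] [TopologicalSpace A]
    [IsTopologicalGroup A] (β : M → A →* A) (hβ : Continuous fun x : M × A => β x.1 x.2) :
    H2 M A →* H2 M A :=
  let F : (M → M → M → M → A) →* (M → M → M → M → A) :=
    { toFun := fun c x y z m => β m (c x y z m)
      map_one' := by funext x y z m; simp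
      map_mul' := fun c d => by funext x y z m; simp }
  have hF : ∀ (s : Set M) (f : M → A), ContinuousOn f s → ContinuousOn (fun m => β m (f m)) s :=
    fun s f hf => hβ.comp_continuousOn (continuousOn_id.prodMk hf)
  have hZ : ∀ c ∈ cocycles M A, F c ∈ cocycles M A := by
    rintro c ⟨U, hU, hc, hc'⟩
    refine ⟨U, hU, fun x y z => hF _ _ (hc x y z), fun w x y z m hw hx hy hz => ?_⟩
    have h := congrArg (β m) (hc' w x y z m hw hx hy hz)
    simpa [F] using h
  QuotientGroup.map _ _
    { toFun := fun c => (⟨F c, hZ c c.2⟩ : cocycles M A)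
      map_one' := Subtype.ext (map_one F)
      map_mul' := fun c d => Subtype.ext (map_mul F _ _) } (by
    intro c hcb
    obtain ⟨U, hU, b, hb, hc⟩ := Subgroup.mem_subgroupOf.1 hcb
    change F c ∈ coboundaries M A
    refine ⟨U, hU, fun x y m => β m (b x y m), fun x y => hF _ _ (hb x y),
      fun x y z m hx hy hz => ?_⟩
    have h := congrArg (β m) (hc x y z m hx hy hz)
    simpa [F] using h)

end Cech

/-! ### Bundle gerbes -/

section Gerbes

/-- An `A` bundle gerbe over `M`: a map `π : Y → M` with local sections, a principal `A`-bundle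
`P` over `Y ×_M Y`, and an associative, `A`-equivariant, continuous multiplication
`P_{(y₁, y₂)} × P_{(y₂, y₃)} → P_{(y₁, y₃)}`. -/
structure BundleGerbe (A M : Type u) [CommGroup A] [TopologicalSpace A]
    [TopologicalSpace M] where
  Y : Type u
  [topY : TopologicalSpace Y]
  π : Y → M
  continuous_π : Continuous π
  localSections_π : HasLocalSections π
  P : PrincipalBundle A {y : Y × Y // π y.1 = π y.2}
  mul : ∀ p q : P.total, (P.proj p).1.2 = (P.proj q).1.1 → P.total
  proj_mul : ∀ p q h, (P.proj (mul p q h)).1 = ((P.proj p).1.1, (P.proj q).1.2)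
  continuous_mul : Continuous
    fun x : {x : P.total × P.total // (P.proj x.1).1.2 = (P.proj x.2).1.1} =>
      mul x.1.1 x.1.2 x.2
  mul_act : ∀ p q a b h h', mul (P.act p a) (P.act q b) h' = P.act (mul p q h) (a * b)
  mul_assoc : ∀ p q r h₁ h₂ h₃ h₄, mul (mul p q h₁) r h₂ = mul p (mul q r h₃) h₄

attribute [instance] BundleGerbe.topY

/-- `c` is the (Dixmier–Douady) class of the bundle gerbe: for an open cover `U`, sections
`s_x : U_x → Y` and sections `σ_{xy}` of the pullback of `P` along
`(s_x, s_y) : U_x ∩ U_y → Y ×_M Y`, the class `c` is represented by the cocycle `γ` such that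
`σ_{xy} σ_{yz} = σ_{xz} γ_{xyz}`. -/
def BundleGerbe.IsClass {A M : Type u} [CommGroup A] [TopologicalSpace A] [IsTopologicalGroup A]
    [TopologicalSpace M] (𝒢 : BundleGerbe A M) (c : Cech.H2 M A) : Prop :=
  ∃ U : M → Set M, Cech.IsPointedCover U ∧
  ∃ s : M → M → 𝒢.Y, (∀ x, ContinuousOn (s x) (U x)) ∧ (∀ x, ∀ m ∈ U x, 𝒢.π (s x m) = m) ∧
  ∃ σ : M → M → M → 𝒢.P.total, (∀ x y, ContinuousOn (σ x y) (U x ∩ U y)) ∧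
    (∀ x y, ∀ m ∈ U x ∩ U y, (𝒢.P.proj (σ x y m)).1 = (s x m, s y m)) ∧
  ∃ γ : Cech.cocycles M A,
    (∀ x y z, ∀ m ∈ U x ∩ U y ∩ U z, ∀ h,
      𝒢.mul (σ x y m) (σ y z m) h = 𝒢.P.act (σ x z m) (γ.1 x y z m)) ∧
    c = Cech.H2.mk γ

variable {H G M : Type u} [Group H] [TopologicalSpace H] [IsTopologicalGroup H]
  [Group G] [TopologicalSpace G] [IsTopologicalGroup G] [TopologicalSpace M]

namespace CrossedModule

variable (K : CrossedModule H G)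

/-- The total space of the pullback `φ^*(H)` of the `t(G)`-bundle `H → H / t(G)`. -/
abbrev Pullback (φ : C(M, K.Out)) : Type u := {y : M × H // φ y.1 = QuotientGroup.mk y.2}

theorem pullback_localSections (hH : HasLocalSections (QuotientGroup.mk : H → K.Out))
    (φ : C(M, K.Out)) : HasLocalSections fun y : K.Pullback φ => y.1.1 := by
  intro m
  obtain ⟨V, hV, hm, s, hs, hsec⟩ := hH (φ m)
  refine ⟨φ ⁻¹' V, hV.preimage φ.continuous, hm,
    fun x => ⟨(x.1, s ⟨φ x.1, x.2⟩), (hsec ⟨φ x.1, x.2⟩).symm⟩, ?_, fun _ => rfl⟩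
  refine Continuous.subtype_mk (continuous_subtype_val.prodMk (hs.comp ?_)) _
  exact Continuous.subtype_mk (φ.continuous.comp continuous_subtype_val) _

/-- The fibre product `φ^*(H) ×_M φ^*(H)`. -/
abbrev Pullback2 (φ : C(M, K.Out)) : Type u :=
  {y : K.Pullback φ × K.Pullback φ // y.1.1.1 = y.2.1.1}

/-- The map `φ^*(H) ×_M φ^*(H) → t(G)`, `((m, h), (m, h')) ↦ h⁻¹ h'`. -/
def difference (φ : C(M, K.Out)) (y : K.Pullback2 φ) : K.t.range :=
  ⟨(y.1.1.1.2)⁻¹ * y.1.2.1.2, QuotientGroup.eq.1 (by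
    rw [← y.1.1.2, ← y.1.2.2, y.2])⟩

theorem continuous_difference (φ : C(M, K.Out)) : Continuous (K.difference φ) := by
  refine Continuous.subtype_mk ?_ _
  fun_prop

/-- Pairs of a point `y` of `φ^*(H) ×_M φ^*(H)` and a lift to `G` of its difference. -/
abbrev LiftingTotal (φ : C(M, K.Out)) : Type u :=
  {x : K.Pullback2 φ × G // K.t.rangeRestrict x.2 = K.difference φ x.1}

/-- The `G₁`-bundle over `φ^*(H) ×_M φ^*(H)` obtained by pulling back `G → t(G)` along the
difference map. -/
def liftingBundle (hG : HasLocalSections K.t.rangeRestrict) (φ : C(M, K.Out)) :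
    PrincipalBundle K.G₁ (K.Pullback2 φ) :=
  let pr : K.LiftingTotal φ → K.Pullback2 φ := fun x => x.1.1
  let ac : K.LiftingTotal φ → K.G₁ → K.LiftingTotal φ := fun x a => ⟨(x.1.1, x.1.2 * a), by
    rw [map_mul, show K.t.rangeRestrict (a : G) = 1 from Subtype.ext a.2, mul_one]; exact x.2⟩
  have hpr : Continuous pr := continuous_fst.comp continuous_subtype_val
  have hac : Continuous fun x : K.LiftingTotal φ × K.G₁ => ac x.1 x.2 := by
    refine Continuous.subtype_mk ?_ _
    fun_prop
  have ac_mul : ∀ x a b, ac x (a * b) = ac (ac x a) b := fun x a b =>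
    Subtype.ext (Prod.ext rfl (mul_assoc _ _ _).symm)
  { total := K.LiftingTotal φ
    proj := pr
    continuous_proj := hpr
    act := ac
    continuous_act := hac
    act_one := fun x => Subtype.ext (Prod.ext rfl (mul_one _))
    act_mul := ac_mul
    proj_act := fun _ _ => rfl
    locally_trivial := by
      intro y
      obtain ⟨V, hV, hy, s, hs, hsec⟩ := hG (K.difference φ y)
      refine ⟨K.difference φ ⁻¹' V, hV.preimage (K.continuous_difference φ), hy, ?_⟩
      have hval : ∀ x : pr ⁻¹' (K.difference φ ⁻¹' V),
          (s ⟨K.difference φ (pr x), x.2⟩)⁻¹ * x.1.1.2 ∈ K.G₁ := fun x => by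
        have h1 : K.t (s ⟨K.difference φ (pr x), x.2⟩) = K.difference φ (pr x) :=
          congrArg Subtype.val (hsec ⟨K.difference φ (pr x), x.2⟩)
        have h2 : K.t x.1.1.2 = K.difference φ (pr x) := congrArg Subtype.val x.1.2
        rw [MonoidHom.mem_ker, map_mul, map_inv, h1, h2, inv_mul_cancel]
      refine locally_trivial_of_section hpr hac ac_mul (fun _ _ => rfl)
        (fun x => ⟨(x.1, s ⟨K.difference φ x.1, x.2⟩), hsec ⟨K.difference φ x.1, x.2⟩⟩) ?_
        (fun x => rfl) (fun x => ⟨_, hval x⟩) ?_ ?_ ?_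
      · refine Continuous.subtype_mk (continuous_subtype_val.prodMk (hs.comp ?_)) _
        exact Continuous.subtype_mk
          ((K.continuous_difference φ).comp continuous_subtype_val) _
      · refine Continuous.subtype_mk (Continuous.mul (Continuous.inv (hs.comp ?_)) ?_) _
        · exact Continuous.subtype_mk
            ((K.continuous_difference φ).comp (hpr.comp continuous_subtype_val)) _
        · exact continuous_snd.comp (continuous_subtype_val.comp continuous_subtype_val)
      · intro x
        exact Subtype.ext (Prod.ext rfl (mul_inv_cancel_left _ _))
      · rintro ⟨_, hx⟩ x a rfl
        exact Subtype.ext (inv_mul_cancel_left _ _) }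

/-- The multiplication `((y₁, y₂), g) ((y₂, y₃), g') = ((y₁, y₃), g g')`. -/
def liftingMul (φ : C(M, K.Out)) (p q : K.LiftingTotal φ) (h : p.1.1.1.2 = q.1.1.1.1) :
    K.LiftingTotal φ :=
  ⟨(⟨(p.1.1.1.1, q.1.1.1.2), by rw [p.1.1.2, h, q.1.1.2]⟩, p.1.2 * q.1.2), by
    rw [map_mul, p.2, q.2]
    refine Subtype.ext ?_
    have h' : p.1.1.1.2.1.2 = q.1.1.1.1.1.2 := by rw [h]
    change (p.1.1.1.1.1.2)⁻¹ * p.1.1.1.2.1.2 * ((q.1.1.1.1.1.2)⁻¹ * q.1.1.1.2.1.2)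
      = (p.1.1.1.1.1.2)⁻¹ * q.1.1.1.2.1.2
    rw [h']
    group⟩

theorem continuous_liftingMul (φ : C(M, K.Out)) : Continuous
    fun x : {x : K.LiftingTotal φ × K.LiftingTotal φ // x.1.1.1.1.2 = x.2.1.1.1.1} =>
      K.liftingMul φ x.1.1 x.1.2 x.2 := by
  refine Continuous.subtype_mk (Continuous.prodMk (Continuous.subtype_mk ?_ _) ?_) _ <;> fun_prop

/-- The lifting bundle gerbe of `φ^*(H)` for the central extension `G₁ → G → t(G)`: its bundle is
the pullback of `G → t(G)` to `φ^*(H) ×_M φ^*(H)`, and its multiplication is that of `G`. -/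
def liftingGerbe (hG : HasLocalSections K.t.rangeRestrict)
    (hH : HasLocalSections (QuotientGroup.mk : H → K.Out)) (φ : C(M, K.Out)) :
    BundleGerbe K.G₁ M where
  Y := K.Pullback φ
  π y := y.1.1
  continuous_π := continuous_fst.comp continuous_subtype_val
  localSections_π := K.pullback_localSections hH φ
  P := K.liftingBundle hG φ
  mul p q h := K.liftingMul φ p q h
  proj_mul _ _ _ := rfl
  continuous_mul := K.continuous_liftingMul φ
  mul_act p q a b h h' := by
    refine Subtype.ext (Prod.ext rfl ?_)
    have key : ∀ g k : G, g * (a : G) * (k * (b : G)) = g * k * ((a : G) * (b : G)) := by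
      intro g k
      rw [mul_assoc, ← mul_assoc (a : G), K.G₁_central a k]
      simp only [mul_assoc]
    exact key _ _
  mul_assoc p q r _ _ _ _ := Subtype.ext (Prod.ext rfl (mul_assoc _ _ _))

/-- The action of `Map(M, H / t(G))` on `H²(M, G₁)` induced by `α`. -/
def twist (f : C(M, K.Out)) : Cech.H2 M K.G₁ →* Cech.H2 M K.G₁ :=
  Cech.H2.map (fun m => K.outAct (f m)) (K.continuous_outAct.comp
    ((f.continuous.comp continuous_fst).prodMk continuous_snd))

end CrossedModule

end Gerbes

/-! Everything is read off from local sections. Over a cover, sections p_x of a bibundle give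
transition functions g_xy in `G` and structure functions h_x = ψ(p_x) in `H`, with g_xy g_yz = g_xz
and h_y = h_x t(g_xy). Bibundles sharing such data are isomorphic (`Bibundle.isIso_of_sectionData`),
and all such data occur (`Bibundle.exists_of_cocycle`). The product of (g, h) and (g', h') has
transition functions α(h'_x)⁻¹(g_xy) g'_xy and structure functions h_x h'_x, so the group axioms
become identities in the crossed module.

Extensions are the bibundles admitting sections with h_x = 1, which forces g_xy into ker t. If the
type is trivial, h_x lifts locally to `G`, and dividing p_x by the lift achieves h_x = 1
(`exists_isIso_extend`). An isomorphism of extensions preserves ψ, hence is given locally by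
`G₁`-valued functions and descends (`isIso_of_extend_isIso`). This gives exactness and injectivity
of ι.

For a map φ, choose local lifts s_x to `H` and lifts g_xy of s_x⁻¹ s_y to `G`. Their failure to be a
cocycle is central, and it is a cocycle representing the class of the lifting gerbe. It is a
coboundary exactly when the g_xy can be corrected to the transition functions of a bibundle of type
φ (`isClass_one_iff`). The class does not depend on the choices (`mk_cocycle_eq`); the choices exist
over a paracompact Hausdorff base (`exists_liftData`); multiplying choices by the product formula
for bibundles gives the crossed homomorphism law (`mul_cocycle`). -/

namespace Cech

/-! ### Pointed covers and extension of local data to total functions. -/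

theorem IsPointedCover.isOpen {M : Type u} [TopologicalSpace M] {U : M → Set M}
    (hU : IsPointedCover U) (x : M) : IsOpen (U x) := (hU x).1

theorem IsPointedCover.mem {M : Type u} [TopologicalSpace M] {U : M → Set M}
    (hU : IsPointedCover U) (x : M) : x ∈ U x := (hU x).2

/-- A choice, for each index `x` and point `m`, of an index whose set contains `m`, equal to `x`
whenever `m ∈ U x`. It extends local data defined over a pointed cover to all of `M`. -/
theorem IsPointedCover.exists_reindex {M : Type u} [TopologicalSpace M] {U : M → Set M}
    (hU : IsPointedCover U) :
    ∃ r : M → M → M, (∀ x m, m ∈ U (r x m)) ∧ ∀ x, ∀ m ∈ U x, r x m = x := by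
  classical
  refine ⟨fun x m => if m ∈ U x then x else m, fun x m => ?_, fun x m hm => if_pos hm⟩
  by_cases h : m ∈ U x
  · simp [h]
  · simpa [h] using hU.mem m

end Cech

/-- A subtype-valued map is continuous on a set if its underlying map is. -/
theorem continuousOn_subtype_mk {X Y : Type*} [TopologicalSpace X] [TopologicalSpace Y]
    {p : Y → Prop} {f : X → {y // p y}} {s : Set X}
    (h : ContinuousOn (fun x => (f x : Y)) s) : ContinuousOn f s :=
  Topology.IsInducing.subtypeVal.continuousOn_iff.2 h

/-- A map defined on a subtype and continuous there extends to a map continuous on that set. -/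
theorem exists_continuousOn_extension {X Y : Type*} [TopologicalSpace X] [TopologicalSpace Y]
    {s : Set X} (f : s → Y) (hf : Continuous f) (f₀ : X → Y) :
    ∃ F : X → Y, ContinuousOn F s ∧ (∀ x (h : x ∈ s), F x = f ⟨x, h⟩) ∧ ∀ x ∉ s, F x = f₀ x := by
  classical
  refine ⟨fun x => if h : x ∈ s then f ⟨x, h⟩ else f₀ x, ?_, fun x h => dif_pos h,
    fun x h => dif_neg h⟩
  rw [continuousOn_iff_continuous_domRestrict]
  convert hf using 1
  funext x
  exact dif_pos x.2

/-! ### Principal bundles: charts and division in the fibres. -/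

namespace PrincipalBundle

variable {G M : Type u} [Group G] [TopologicalSpace G] [TopologicalSpace M]

/-- Off `U` the section is continued by an arbitrary choice of points in the fibres. Algebraic
identities between sections then hold at every point of `M`, and only continuity refers to the
cover; this convention is kept throughout. -/
theorem exists_chart (P : PrincipalBundle G M) (m : M) :
    ∃ U : Set M, IsOpen U ∧ m ∈ U ∧ ∃ (s : M → P.total) (d : P.total → G),
      ContinuousOn s U ∧ ContinuousOn d (P.proj ⁻¹' U) ∧ (∀ x, P.proj (s x) = x) ∧
      (∀ p, P.proj p ∈ U → P.act (s (P.proj p)) (d p) = p) ∧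
      ∀ p g, P.proj p ∈ U → d (P.act p g) = d p * g := by
  obtain ⟨U, hU, hm, s, d, hs, hd, hp, hr, ha, -⟩ := P.exists_section m
  choose s₀ hs₀ using P.proj_surjective
  obtain ⟨s', hs', hs1, hs2⟩ := exists_continuousOn_extension s hs s₀
  obtain ⟨d', hd', hd1, -⟩ := exists_continuousOn_extension d hd fun _ => 1
  refine ⟨U, hU, hm, s', d', hs', hd', fun x => ?_, fun p h => ?_, fun p g h => ?_⟩
  · by_cases h : x ∈ U
    · rw [hs1 x h, hp]
    · rw [hs2 x h, hs₀]
  · rw [hs1 _ h, hd1 p h]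
    exact hr ⟨p, h⟩
  · have h' : P.act p g ∈ P.proj ⁻¹' U := by
      rw [Set.mem_preimage, P.proj_act]; exact h
    rw [hd1 _ h', hd1 _ h]
    exact ha _ _ g rfl

/-- A chart coordinate is equivariant with values in `G`, where one can cancel. -/
theorem act_injective (P : PrincipalBundle G M) (p : P.total) :
    Function.Injective (P.act p) := by
  intro g k h
  obtain ⟨U, -, hm, s, d, -, -, -, -, ha⟩ := P.exists_chart (P.proj p)
  have h1 := ha p g hm
  rw [h, ha p k hm] at h1
  exact (mul_left_cancel h1).symm

variable [IsTopologicalGroup G]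

/-- The element of the structure group carrying `p` to `q`, for `p` and `q` in the same fibre. -/
noncomputable def div (P : PrincipalBundle G M) (p q : P.total) : G :=
  open Classical in
  if h : P.proj p = P.proj q then (Bibundle.exists_eq_act P h).choose else 1

theorem act_div (P : PrincipalBundle G M) {p q : P.total} (h : P.proj p = P.proj q) :
    P.act p (P.div p q) = q := by
  rw [div, dif_pos h]
  exact (Bibundle.exists_eq_act P h).choose_spec.symm

theorem div_eq (P : PrincipalBundle G M) {p q : P.total} {g : G} (h : q = P.act p g) :
    P.div p q = g := by
  refine P.act_injective p ?_
  rw [P.act_div, h]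
  rw [h, P.proj_act]

theorem div_act_right (P : PrincipalBundle G M) {p q : P.total} (h : P.proj p = P.proj q) (g : G) :
    P.div p (P.act q g) = P.div p q * g :=
  P.div_eq (by rw [P.act_mul, P.act_div h])

theorem div_act_left (P : PrincipalBundle G M) {p q : P.total} (h : P.proj p = P.proj q) (g : G) :
    P.div (P.act p g) q = g⁻¹ * P.div p q :=
  P.div_eq (by rw [← P.act_mul, mul_inv_cancel_left, P.act_div h])

/-- In terms of a chart coordinate d near the common base point, the quotient of p and q is d(p)⁻¹
d(q). -/
theorem continuousOn_div (P : PrincipalBundle G M) :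
    ContinuousOn (fun x : P.total × P.total => P.div x.1 x.2)
      {x | P.proj x.1 = P.proj x.2} := by
  rintro ⟨p, q⟩ hpq
  obtain ⟨U, hU, hm, s, d, -, hd, -, hr, ha⟩ := P.exists_chart (P.proj p)
  have hV : ∀ y : P.total, P.proj y ∈ U → P.proj ⁻¹' U ∈ 𝓝 y := fun y hy =>
    (hU.preimage P.continuous_proj).mem_nhds hy
  have hq : P.proj q ∈ U := (show P.proj p = P.proj q from hpq) ▸ hm
  have h1 : ContinuousAt (fun x : P.total × P.total => (d x.1)⁻¹ * d x.2) (p, q) :=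
    ((hd.continuousAt (hV p hm)).comp continuousAt_fst).inv.mul
      (ContinuousAt.comp (g := d) (f := Prod.snd) (hd.continuousAt (hV q hq)) continuousAt_snd)
  refine h1.continuousWithinAt.congr_of_eventuallyEq ?_ ?_
  · filter_upwards [self_mem_nhdsWithin,
      mem_nhdsWithin_of_mem_nhds (continuousAt_fst.preimage_mem_nhds (hV p hm))] with x hx hxU
    have h2 := ha x.1 (P.div x.1 x.2) hxU
    rw [P.act_div hx] at h2
    rw [h2, inv_mul_cancel_left]
  · have h2 := ha p (P.div p q) hm
    rw [P.act_div hpq] at h2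
    simp only [h2, inv_mul_cancel_left]

/-! ### Sections, transition functions and gluing of isomorphisms. -/

/-- Sections `p x` of a principal bundle, continuous on the sets `U x` of a pointed cover, with
transition functions `g x y`. Away from the cover the sections are only set-theoretic. -/
structure SectionData (P : PrincipalBundle G M) (U : M → Set M) (p : M → M → P.total)
    (g : M → M → M → G) : Prop where
  cover : Cech.IsPointedCover U
  cont : ∀ x, ContinuousOn (p x) (U x)
  proj : ∀ x m, P.proj (p x m) = m
  trans : ∀ x y m, p y m = P.act (p x m) (g x y m)

theorem SectionData.of_sections {P : PrincipalBundle G M} {U : M → Set M} {p : M → M → P.total}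
    (hU : Cech.IsPointedCover U) (hc : ∀ x, ContinuousOn (p x) (U x))
    (hp : ∀ x m, P.proj (p x m) = m) :
    P.SectionData U p fun x y m => P.div (p x m) (p y m) :=
  ⟨hU, hc, hp, fun x y m => (P.act_div (by rw [hp, hp])).symm⟩

theorem exists_sectionData (P : PrincipalBundle G M) :
    ∃ U p g, P.SectionData U p g := by
  choose U hU hm s d hs _ hp _ _ using P.exists_chart
  exact ⟨U, s, _, .of_sections (fun x => ⟨hU x, hm x⟩) hs hp⟩

namespace SectionData

variable {P Q : PrincipalBundle G M} {U V : M → Set M} {p : M → M → P.total} {q : M → M → Q.total}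
  {g : M → M → M → G}

theorem mono (h : P.SectionData U p g) (hV : Cech.IsPointedCover V) (hVU : ∀ x, V x ⊆ U x) :
    P.SectionData V p g :=
  ⟨hV, fun x => (h.cont x).mono (hVU x), h.proj, h.trans⟩

theorem eq_div (h : P.SectionData U p g) (x y m : M) : g x y m = P.div (p x m) (p y m) :=
  (P.div_eq (h.trans x y m)).symm

theorem cont_trans (h : P.SectionData U p g) (x y : M) :
    ContinuousOn (g x y) (U x ∩ U y) := by
  have h1 := P.continuousOn_div.comp
    (((h.cont x).mono Set.inter_subset_left).prodMk ((h.cont y).mono Set.inter_subset_right))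
    (fun m _ => by simp only [Set.mem_ofPred_eq, h.proj])
  exact h1.congr fun m _ => h.eq_div x y m

/-- Freeness of the action; no membership in the cover is needed, because the sections are total. -/
theorem trans_mul (h : P.SectionData U p g) (x y z m : M) : g x y m * g y z m = g x z m :=
  P.act_injective (p x m) (by rw [P.act_mul, ← h.trans, ← h.trans, ← h.trans])

/-- Change of gauge: the effect on transition functions of moving each section by a local `G`-valued
function. -/
theorem act (h : P.SectionData U p g) {k : M → M → G} (hk : ∀ x, ContinuousOn (k x) (U x)) :
    P.SectionData U (fun x m => P.act (p x m) (k x m))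
      fun x y m => (k x m)⁻¹ * g x y m * k y m :=
  ⟨h.cover, fun x => P.continuous_act.comp_continuousOn ((h.cont x).prodMk (hk x)),
    fun x m => by rw [P.proj_act, h.proj],
    fun x y m => by rw [h.trans x y m, ← P.act_mul, ← P.act_mul]; congr 1; group⟩

theorem map (h : P.SectionData U p g) (f : P.total ≃ₜ Q.total)
    (hf : ∀ p, Q.proj (f p) = P.proj p) (hfa : ∀ p g, f (P.act p g) = Q.act (f p) g) :
    Q.SectionData U (fun x m => f (p x m)) g :=
  ⟨h.cover, fun x => f.continuous.comp_continuousOn (h.cont x),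
    fun x m => by rw [hf, h.proj], fun x y m => by rw [← hfa, h.trans x y m]⟩

/-- The coordinate of a point relative to the section `p x`. -/
theorem continuousOn_coord (h : P.SectionData U p g) (x : M) :
    ContinuousOn (fun z => P.div (p x (P.proj z)) z) (P.proj ⁻¹' U x) :=
  P.continuousOn_div.comp
    (((h.cont x).comp P.continuous_proj.continuousOn fun _ hz => hz).prodMk continuousOn_id)
    fun _ _ => h.proj x _

theorem act_coord (h : P.SectionData U p g) (x : M) (z : P.total) :
    P.act (p x (P.proj z)) (P.div (p x (P.proj z)) z) = z :=
  P.act_div (h.proj _ _)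

theorem coord (h : P.SectionData U p g) (x y : M) (z : P.total) :
    P.div (p y (P.proj z)) z = (g x y (P.proj z))⁻¹ * P.div (p x (P.proj z)) z := by
  rw [h.trans x y, P.div_act_left (h.proj _ _)]

/-- The map sends p_x a to q_x a. Equality of the transition functions makes this independent of x,
so the base point itself may serve as index in the definition, while continuity near a point is
checked with the index held fixed. -/
theorem exists_map (hp : P.SectionData U p g) (hq : Q.SectionData U q g) :
    ∃ f : P.total → Q.total, Continuous f ∧ (∀ z, Q.proj (f z) = P.proj z) ∧
      (∀ z k, f (P.act z k) = Q.act (f z) k) ∧ ∀ x m, f (p x m) = q x m := by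
  let f : P.total → Q.total := fun z =>
    Q.act (q (P.proj z) (P.proj z)) (P.div (p (P.proj z) (P.proj z)) z)
  have hf : ∀ x z, f z = Q.act (q x (P.proj z)) (P.div (p x (P.proj z)) z) := fun x z => by
    rw [hq.trans (P.proj z) x, hp.coord (P.proj z) x, ← Q.act_mul, mul_inv_cancel_left]
  refine ⟨f, continuous_iff_continuousAt.2 fun z => ?_, fun z => ?_, fun z k => ?_, fun x m => ?_⟩
  · have h1 : ContinuousOn f (P.proj ⁻¹' U (P.proj z)) :=
      (Q.continuous_act.comp_continuousOn
        (((hq.cont (P.proj z)).comp P.continuous_proj.continuousOn fun _ hz => hz).prodMk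
          (hp.continuousOn_coord (P.proj z)))).congr fun w _ => hf (P.proj z) w
    exact h1.continuousAt (((hp.cover.isOpen _).preimage P.continuous_proj).mem_nhds
      (hp.cover.mem _))
  · rw [Q.proj_act, hq.proj]
  · simp only [f]
    rw [P.proj_act, P.div_act_right (hp.proj _ _), Q.act_mul]
  · rw [hf x, hp.proj, P.div_eq (P.act_one _).symm, Q.act_one]

/-- Bundles with the same transition functions are isomorphic. -/
theorem exists_iso (hp : P.SectionData U p g) (hq : Q.SectionData U q g) :
    ∃ f : P.total ≃ₜ Q.total, (∀ z, Q.proj (f z) = P.proj z) ∧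
      (∀ z k, f (P.act z k) = Q.act (f z) k) ∧ ∀ x m, f (p x m) = q x m := by
  obtain ⟨f, hfc, hf, hfa, hfp⟩ := hp.exists_map hq
  obtain ⟨k, hkc, hk, hka, hkq⟩ := hq.exists_map hp
  refine ⟨⟨⟨f, k, fun z => ?_, fun z => ?_⟩, hfc, hkc⟩, hf, hfa, hfp⟩
  · rw [← hp.act_coord (P.proj z) z, hfa, hka, hfp, hkq]
  · rw [← hq.act_coord (Q.proj z) z, hka, hfa, hkq, hfp]

theorem isIso (hp : P.SectionData U p g) (hq : Q.SectionData U q g) : P.IsIso Q := by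
  obtain ⟨f, h1, h2, -⟩ := hp.exists_iso hq
  exact ⟨f, h1, h2⟩

end SectionData

variable (G M) in
/-- The unit section of the trivial bundle. -/
def unitSection : M → M → (trivial G M).total := fun _ m => (m, (1 : G))

theorem trivial_sectionData :
    (trivial G M).SectionData (fun _ => Set.univ) (unitSection G M) fun _ _ _ => 1 :=
  ⟨Cech.isPointedCover_univ M,
    fun _ => (continuous_id.prodMk continuous_const :
      Continuous fun m : M => (m, (1 : G))).continuousOn,
    fun _ _ => rfl, fun _ _ _ => ((trivial G M).act_one _).symm⟩

/-! ### Clutching: principal bundles from cocycles. -/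

/-- The fibre bundle core of a cocycle of transition functions. -/
def clutchingCore (U : M → Set M) (g : M → M → M → G)
    (hU : Cech.IsPointedCover U) (hg : ∀ x y, ContinuousOn (g x y) (U x ∩ U y))
    (hc : ∀ x y z m, g x y m * g y z m = g x z m) : FiberBundleCore M M G where
  baseSet := U
  isOpen_baseSet := hU.isOpen
  indexAt := id
  mem_baseSet_at := hU.mem
  -- Since p_x = p_y g_yx, the coordinate a relative to p_x becomes g_yx a relative to p_y. Left
  -- multiplications commute with right translations, so the right action of `G` is well defined on
  -- the glued space.
  coordChange x y m a := g y x m * a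
  coordChange_self x m _ a := by rw [mul_eq_left.1 (hc x x x m), one_mul]
  continuousOn_coordChange x y :=
    ((hg y x).comp continuousOn_fst fun a ha => ⟨ha.1.2, ha.1.1⟩).mul continuousOn_snd
  coordChange_comp x y z m _ a := by rw [← mul_assoc, hc]

/-- A cocycle of transition functions comes from a principal bundle. -/
theorem exists_of_cocycle (U : M → Set M) (g : M → M → M → G)
    (hU : Cech.IsPointedCover U) (hg : ∀ x y, ContinuousOn (g x y) (U x ∩ U y))
    (hc : ∀ x y z m, g x y m * g y z m = g x z m) :
    ∃ (P : PrincipalBundle G M) (p : M → M → P.total), P.SectionData U p g := by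
  let Z := clutchingCore U g hU hg hc
  let E := Z.TotalSpace
  let fib : E → G := fun z => z.2
  let mk : M → G → E := fun m a => ⟨m, a⟩
  let act : E → G → E := fun z k => ⟨z.1, fib z * k⟩
  let e : ∀ x : M, Bundle.Trivialization G Z.proj := fun x => Z.localTriv x
  have he : ∀ (x : M) (z : E), e x z = (z.1, g x z.1 z.1 * fib z) := fun x z => rfl
  have hes : ∀ (x m : M) (a : G), (e x).toOpenPartialHomeomorph.symm (m, a) =
      (⟨m, g m x m * a⟩ : E) := fun x m a => rfl
  have hproj : Continuous Z.proj := Z.continuous_proj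
  have hact : Continuous fun x : E × G => act x.1 x.2 := by
    refine continuous_iff_continuousAt.2 fun y => ?_
    have hy : Z.proj y.1 ∈ (e y.1.1).baseSet := hU.mem _
    refine (e y.1.1).continuousAt_of_comp_left (f := fun x : E × G => act x.1 x.2)
      (hproj.comp continuous_fst).continuousAt hy ?_
    have h1 : ContinuousAt (fun x : E × G => e y.1.1 x.1) y :=
      ContinuousAt.comp (f := Prod.fst) (g := e y.1.1) (x := y)
        ((e y.1.1).continuousOn.continuousAt
          ((e y.1.1).open_source.mem_nhds ((e y.1.1).mem_source.2 hy))) continuousAt_fst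
    refine ((continuousAt_fst.comp h1).prodMk
      ((continuousAt_snd.comp h1).mul continuousAt_snd)).congr (.of_forall fun x => ?_)
    change ((e y.1.1 x.1).1, (e y.1.1 x.1).2 * x.2) = e y.1.1 (act x.1 x.2)
    rw [he, he, mul_assoc]
  -- This is the section with coordinate 1 in the chart of index x. The fibre over m is stored in
  -- the chart of index m, hence the value g_mx(m).
  have hsec : ∀ x : M, ContinuousOn (fun m => (⟨m, g m x m⟩ : E)) (U x) := fun x => by
    have h1 : ContinuousOn (fun m : M => (e x).toOpenPartialHomeomorph.symm (m, (1 : G))) (U x) :=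
      (e x).toOpenPartialHomeomorph.continuousOn_symm.comp
        (continuous_id.prodMk continuous_const).continuousOn
        fun m hm => (e x).mem_target.2 hm
    refine h1.congr fun m _ => ?_
    simp only [hes, mul_one]
  have act_mul : ∀ z a b, act z (a * b) = act (act z a) b := fun z a b =>
    congrArg (mk z.1) (mul_assoc (fib z) a b).symm
  refine ⟨{
    total := E
    proj := Z.proj
    continuous_proj := hproj
    act := act
    continuous_act := hact
    act_one := fun z => congrArg (mk z.1) (mul_one (fib z))
    act_mul := act_mul
    proj_act := fun _ _ => rfl
    locally_trivial := fun m => ⟨U m, hU.isOpen m, hU.mem m, ?_⟩ },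
    fun x m => ⟨m, g m x m⟩, hU, hsec, fun _ _ => rfl,
    fun x y m => congrArg (mk m) (hc m x y m).symm⟩
  refine locally_trivial_of_section hproj hact act_mul (fun _ _ => rfl)
    (fun x => ⟨x, g x m x⟩) (continuousOn_iff_continuous_domRestrict.1 (hsec m)) (fun _ => rfl)
    (fun z => (e m z).2) ?_ ?_ ?_
  · refine continuous_snd.comp (continuousOn_iff_continuous_domRestrict.1
      ((e m).continuousOn.mono fun z hz => (e m).mem_source.2 hz))
  · rintro ⟨z, hz⟩
    refine congrArg (mk z.1) ?_
    change g z.1 m z.1 * (g m z.1 z.1 * fib z) = fib z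
    rw [← mul_assoc, hc, mul_eq_left.1 (hc z.1 z.1 z.1 z.1), one_mul]
  · rintro ⟨z, hz⟩ x k hzk
    obtain rfl : z = act ⟨x, g x m x⟩ k := hzk
    change g m x x * (g x m x * k) = k
    rw [← mul_assoc, hc, mul_eq_left.1 (hc m m m x), one_mul]

end PrincipalBundle

/-! ### Transition functions of contracted products. -/

namespace PrincipalBundle

section Contracted

variable {A G M : Type u} [Group A] [TopologicalSpace A] [IsTopologicalGroup A]
  [Group G] [TopologicalSpace G] [TopologicalSpace M]
  {P : PrincipalBundle A M} {Q : PrincipalBundle G M} {L : LeftAction A Q}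

variable (L) in
/-- The sections `p x ⊗ q x` of a contracted product. -/
def contractedSection {p : M → M → P.total} {q : M → M → Q.total}
    (hp : ∀ x m, P.proj (p x m) = m) (hq : ∀ x m, Q.proj (q x m) = m) (x m : M) :
    (contracted P Q L).total :=
  Quotient.mk (shiftSetoid P Q L) ⟨(p x m, q x m), by rw [hp, hq]⟩

/-- The function θ rewrites the left action on q_x as a right action, so that p_y ⊗ q_y = p_x a ⊗
q_x g = p_x ⊗ a q_x g = p_x ⊗ q_x θ g. Both kinds of product and the extension are instances. -/
theorem SectionData.contracted {U : M → Set M} {p : M → M → P.total} {q : M → M → Q.total}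
    {a : M → M → M → A} {g θ : M → M → M → G} (hp : P.SectionData U p a)
    (hq : Q.SectionData U q g)
    (hθ : ∀ x y m, L.lact (a x y m) (q x m) = Q.act (q x m) (θ x y m)) :
    (contracted P Q L).SectionData U (contractedSection L hp.proj hq.proj)
      fun x y m => θ x y m * g x y m where
  cover := hp.cover
  cont x := (isOpenQuotientMap_mk P Q L).continuous.comp_continuousOn
    (continuousOn_subtype_mk ((hp.cont x).prodMk (hq.cont x)))
  proj := hp.proj
  trans x y m := by
    refine (Quotient.sound (s := shiftSetoid P Q L) ⟨a x y m, ?_⟩ :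
      Quotient.mk (shiftSetoid P Q L) _ = Quotient.mk (shiftSetoid P Q L) _).symm
    refine Subtype.ext (Prod.ext (hp.trans x y m) ?_)
    change q y m = L.lact (a x y m)⁻¹ (Q.act (q x m) (θ x y m * g x y m))
    rw [Q.act_mul, ← hθ, ← L.lact_act, ← L.mul_lact, inv_mul_cancel, L.one_lact, hq.trans x y]

end Contracted

end PrincipalBundle

/-! ### Bibundles in terms of local data, and the group of their classes. -/

section Bibundles

variable {H G M : Type u} [Group H] [TopologicalSpace H] [IsTopologicalGroup H]
  [Group G] [TopologicalSpace G] [IsTopologicalGroup G] [TopologicalSpace M]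
  {K : CrossedModule H G}

namespace Bibundle

/-- Bibundles with the same transition functions and the same local structure maps are
isomorphic. -/
theorem isIso_of_sectionData {P Q : Bibundle K M} {U : M → Set M} {p : M → M → P.total}
    {q : M → M → Q.total} {g : M → M → M → G} (hp : P.SectionData U p g)
    (hq : Q.SectionData U q g) (hs : ∀ x m, P.str (p x m) = Q.str (q x m)) : P.IsIso Q := by
  obtain ⟨f, h1, h2, h3⟩ := hp.exists_iso hq
  refine ⟨f, h1, h2, fun z => ?_⟩
  rw [← hp.act_coord (P.proj z) z, h2, h3, Q.str_act, P.str_act, hs]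

theorem str_trans (P : Bibundle K M) {U : M → Set M} {p : M → M → P.total}
    {g : M → M → M → G} (hp : P.SectionData U p g) (x y m : M) :
    P.str (p y m) = P.str (p x m) * K.t (g x y m) := by
  rw [hp.trans x y m, P.str_act]

theorem typeMap_eq (P : Bibundle K M) {p : P.total} {m : M} (h : P.proj p = m) :
    P.typeMap m = QuotientGroup.mk (P.str p) := by
  subst h
  exact P.typeAt_proj p

/-- The sections `p x ⊗ q x` of a product of bibundles. -/
abbrev tensorSection {P Q : Bibundle K M} {p : M → M → P.total} {q : M → M → Q.total}
    (hp : ∀ x m, P.proj (p x m) = m) (hq : ∀ x m, Q.proj (q x m) = m) :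
    M → M → (P.tensor Q).total :=
  PrincipalBundle.contractedSection Q.leftAction hp hq

theorem tensor_sectionData {P Q : Bibundle K M} {U : M → Set M} {p : M → M → P.total}
    {q : M → M → Q.total} {g k : M → M → M → G} (hp : P.SectionData U p g)
    (hq : Q.SectionData U q k) :
    (P.tensor Q).SectionData U (tensorSection hp.proj hq.proj)
      fun x y m => K.α (Q.str (q x m))⁻¹ (g x y m) * k x y m :=
  hp.contracted (L := Q.leftAction) hq fun _ _ _ => rfl

theorem str_tensorSection {P Q : Bibundle K M} {p : M → M → P.total} {q : M → M → Q.total}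
    (hp : ∀ x m, P.proj (p x m) = m) (hq : ∀ x m, Q.proj (q x m) = m) (x m : M) :
    (P.tensor Q).str (tensorSection hp hq x m) = P.str (p x m) * Q.str (q x m) := rfl

theorem trivial_sectionData :
    (trivial K M).SectionData (fun _ => Set.univ) (PrincipalBundle.unitSection G M) fun _ _ _ => 1 :=
  PrincipalBundle.trivial_sectionData

theorem str_unitSection (x m : M) :
    (trivial K M).str (PrincipalBundle.unitSection G M x m) = 1 := map_one K.t

/-- A principal bundle with transition functions `g`, and continuous local functions `s` to `H`
compatible with `g`, define a bibundle. -/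
theorem exists_of_principalBundle (P : PrincipalBundle G M) {U : M → Set M}
    {p : M → M → P.total} {g : M → M → M → G} (hp : P.SectionData U p g) {s : M → M → H}
    (hs : ∀ x, ContinuousOn (s x) (U x)) (hsg : ∀ x y m, s y m = s x m * K.t (g x y m)) :
    ∃ B : Bibundle K M, ∃ b : M → M → B.total, B.SectionData U b g ∧
      ∀ x m, B.str (b x m) = s x m := by
  -- Equivariance forces ψ(p_x a) = s_x t(a); the compatibility `hsg` makes the value independent of
  -- x.
  let ψ : P.total → H := fun z =>
    s (P.proj z) (P.proj z) * K.t (P.div (p (P.proj z) (P.proj z)) z)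
  have hψ : ∀ x z, ψ z = s x (P.proj z) * K.t (P.div (p x (P.proj z)) z) := fun x z => by
    rw [hsg (P.proj z) x, hp.coord (P.proj z) x, mul_assoc, ← map_mul, mul_inv_cancel_left]
  refine ⟨{ P with str := ψ, continuous_str := ?_, str_act := fun z k => ?_ }, p, hp,
    fun x m => ?_⟩
  · refine continuous_iff_continuousAt.2 fun z => ?_
    have h1 : ContinuousOn ψ (P.proj ⁻¹' U (P.proj z)) :=
      (((hs (P.proj z)).comp P.continuous_proj.continuousOn fun _ hz => hz).mul
        (K.continuous_t.comp_continuousOn (hp.continuousOn_coord (P.proj z)))).congr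
        fun w _ => hψ (P.proj z) w
    exact h1.continuousAt (((hp.cover.isOpen _).preimage P.continuous_proj).mem_nhds
      (hp.cover.mem _))
  · simp only [ψ]
    rw [P.proj_act, P.div_act_right (hp.proj _ _), map_mul, mul_assoc]
  · change ψ (p x m) = _
    rw [hψ x, hp.proj, P.div_eq (P.act_one _).symm, map_one, mul_one]

theorem exists_of_cocycle {U : M → Set M} {g : M → M → M → G} {s : M → M → H}
    (hU : Cech.IsPointedCover U) (hg : ∀ x y, ContinuousOn (g x y) (U x ∩ U y))
    (hc : ∀ x y z m, g x y m * g y z m = g x z m) (hs : ∀ x, ContinuousOn (s x) (U x))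
    (hsg : ∀ x y m, s y m = s x m * K.t (g x y m)) :
    ∃ B : Bibundle K M, ∃ b : M → M → B.total, B.SectionData U b g ∧
      ∀ x m, B.str (b x m) = s x m := by
  obtain ⟨P, p, hp⟩ := PrincipalBundle.exists_of_cocycle U g hU hg hc
  exact exists_of_principalBundle P hp hs hsg

/-- Images of sections under isomorphisms have the same transition and structure functions, and
those of the product depend on nothing else. -/
theorem tensor_congr {P P' Q Q' : Bibundle K M} (hP : P.IsIso P') (hQ : Q.IsIso Q') :
    (P.tensor Q).IsIso (P'.tensor Q') := by
  obtain ⟨U, p, g, hp⟩ := P.exists_sectionData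
  obtain ⟨V, q, k, hq⟩ := Q.exists_sectionData
  have hW := hp.cover.inter hq.cover
  replace hp := hp.mono hW fun _ => Set.inter_subset_left
  replace hq := hq.mono hW fun _ => Set.inter_subset_right
  obtain ⟨f, hf, hfa, hfs⟩ := hP
  obtain ⟨e, he, hea, hes⟩ := hQ
  have hp' := hp.map f hf hfa
  have hq' := hq.map e he hea
  refine isIso_of_sectionData (tensor_sectionData hp hq)
    (q := tensorSection hp'.proj hq'.proj) ?_ fun x m => ?_
  · simpa only [hes] using tensor_sectionData hp' hq'
  · rw [str_tensorSection, str_tensorSection, hfs, hes]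

/-- The transition functions agree because α(h h')⁻¹ = α(h')⁻¹ α(h)⁻¹ for the structure functions h
of `Q` and h' of `R`. -/
theorem tensor_assoc (P Q R : Bibundle K M) :
    ((P.tensor Q).tensor R).IsIso (P.tensor (Q.tensor R)) := by
  obtain ⟨U, p, g, hp⟩ := P.exists_sectionData
  obtain ⟨V, q, k, hq⟩ := Q.exists_sectionData
  obtain ⟨W, r, l, hr⟩ := R.exists_sectionData
  have hX := (hp.cover.inter hq.cover).inter hr.cover
  replace hp := hp.mono hX fun _ _ h => h.1.1
  replace hq := hq.mono hX fun _ _ h => h.1.2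
  replace hr := hr.mono hX fun _ _ h => h.2
  have h1 := tensor_sectionData (tensor_sectionData hp hq) hr
  have h2 := tensor_sectionData hp (tensor_sectionData hq hr)
  refine isIso_of_sectionData h1 (q := tensorSection hp.proj (tensor_sectionData hq hr).proj)
    ?_ fun x m => ?_
  · convert h2 using 1
    funext x y m
    rw [str_tensorSection, map_mul, mul_inv_rev, map_mul K.α, MulAut.mul_apply, mul_assoc]
  · simp only [str_tensorSection, mul_assoc]

theorem trivial_tensor (P : Bibundle K M) : ((trivial K M).tensor P).IsIso P := by
  obtain ⟨U, p, g, hp⟩ := P.exists_sectionData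
  have h0 := (trivial_sectionData (K := K) (M := M)).mono hp.cover fun _ => Set.subset_univ _
  refine isIso_of_sectionData (p := tensorSection h0.proj hp.proj) ?_ hp fun x m => ?_
  · simpa only [map_one, one_mul] using tensor_sectionData h0 hp
  · refine (str_tensorSection h0.proj hp.proj x m).trans ?_
    rw [str_unitSection, one_mul]

/-- Requiring the product to have transition and structure functions 1 leaves only h_x⁻¹ and
α(h_x)(g_xy⁻¹), where h_x = ψ(p_x). That these satisfy the cocycle identity uses h_y = h_x t(g_xy)
and the fact that α(t(g)) is conjugation by g. -/
theorem exists_tensor_inverse (P : Bibundle K M) :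
    ∃ Q : Bibundle K M, (Q.tensor P).IsIso (trivial K M) := by
  obtain ⟨U, p, g, hp⟩ := P.exists_sectionData
  have hg : ∀ x y m, K.α (P.str (p y m)) = K.α (P.str (p x m)) * K.α (K.t (g x y m)) :=
    fun x y m => by rw [P.str_trans hp x y, map_mul]
  have hc : ∀ x y z m, K.α (P.str (p x m)) (g x y m)⁻¹ * K.α (P.str (p y m)) (g y z m)⁻¹ =
      K.α (P.str (p x m)) (g x z m)⁻¹ := fun x y z m => by
    rw [hg x y m, MulAut.mul_apply, K.α_t, ← map_mul, ← hp.trans_mul x y z m]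
    congr 1
    group
  have hsg : ∀ x y m, (P.str (p y m))⁻¹ =
      (P.str (p x m))⁻¹ * K.t (K.α (P.str (p x m)) (g x y m)⁻¹) := fun x y m => by
    rw [P.str_trans hp x y, K.t_α, map_inv]
    group
  obtain ⟨Q, q, hq, hqs⟩ := exists_of_cocycle
    (g := fun x y m => K.α (P.str (p x m)) (g x y m)⁻¹) (s := fun x m => (P.str (p x m))⁻¹) hp.cover
    (fun x y => K.continuous_α.comp_continuousOn
      ((P.continuous_str.comp_continuousOn ((hp.cont x).mono Set.inter_subset_left)).prodMk
        (hp.cont_trans x y).inv)) hc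
    (fun x => (P.continuous_str.comp_continuousOn (hp.cont x)).inv) hsg
  refine ⟨Q, ?_⟩
  have h0 := (trivial_sectionData (K := K) (M := M)).mono hp.cover fun _ => Set.subset_univ _
  refine isIso_of_sectionData (p := tensorSection hq.proj hp.proj) ?_ h0 fun x m => ?_
  · convert tensor_sectionData hq hp using 1
    funext x y m
    rw [← MulAut.mul_apply, ← map_mul, inv_mul_cancel, map_one, MulAut.one_apply,
      inv_mul_cancel]
  · rw [str_tensorSection, hqs, inv_mul_cancel, str_unitSection]

theorem IsIso.typeMap_eq {P Q : Bibundle K M} (h : P.IsIso Q) : P.typeMap = Q.typeMap := by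
  obtain ⟨f, hf, -, hfs⟩ := h
  ext m
  obtain ⟨p, rfl⟩ := P.proj_surjective m
  rw [P.typeMap_eq rfl, Q.typeMap_eq (hf p), hfs]

theorem typeMap_tensor (P Q : Bibundle K M) : (P.tensor Q).typeMap = P.typeMap * Q.typeMap := by
  ext m
  obtain ⟨p, rfl⟩ := P.proj_surjective m
  obtain ⟨q, hq⟩ := Q.proj_surjective (P.proj p)
  have h : (P.tensor Q).typeMap (P.proj p) = QuotientGroup.mk (P.str p * Q.str q) :=
    (P.tensor Q).typeMap_eq
      (p := Quotient.mk (PrincipalBundle.shiftSetoid _ _ Q.leftAction) ⟨(p, q), hq.symm⟩) rfl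
  rw [h, ContinuousMap.mul_apply, P.typeMap_eq rfl, Q.typeMap_eq hq, QuotientGroup.mk_mul]

theorem typeMap_trivial : (trivial K M).typeMap = 1 := by
  ext m
  rw [(trivial K M).typeMap_eq (trivial_sectionData.proj m m), str_unitSection]
  rfl

/-- The group of isomorphism classes of bibundles, under the product of bibundles. -/
noncomputable abbrev classGroup (K : CrossedModule H G) (M : Type u) [TopologicalSpace M] :
    Group (Bibun₀ K M) :=
  letI : Mul (Bibun₀ K M) := ⟨Quotient.map₂ tensor fun _ _ h _ _ h' => tensor_congr h h'⟩
  letI : One (Bibun₀ K M) := ⟨(trivial K M).cls⟩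
  letI : Inv (Bibun₀ K M) :=
    ⟨fun z => (Quotient.inductionOn z fun P =>
      (exists_tensor_inverse P).elim fun Q h => ⟨Q.cls, Quotient.sound h⟩ :
        ∃ w : Bibun₀ K M, w * z = 1).choose⟩
  -- A left unit and left inverses suffice, so products with the trivial bundle or the inverse on
  -- the other side need no treatment.
  Group.ofLeftAxioms
    (fun a b c => Quotient.inductionOn₃ a b c fun P Q R => Quotient.sound (tensor_assoc P Q R))
    (fun a => Quotient.inductionOn a fun P => Quotient.sound (trivial_tensor P))
    (fun z => Exists.choose_spec (p := fun w : Bibun₀ K M => w * z = 1) _)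

end Bibundle

/-! ### Extension of `G₁`-bundles and bibundles of trivial type. -/

namespace CrossedModule

/-- A continuous local map to `t(G)` lifts to `G`, continuously near a given point. -/
theorem exists_local_lift {X : Type*} [TopologicalSpace X] (hG : HasLocalSections K.t.rangeRestrict)
    {f : X → H} {U : Set X} {x : X} (hU : IsOpen U) (hx : x ∈ U) (hf : ContinuousOn f U)
    (hr : ∀ m ∈ U, f m ∈ K.t.range) :
    ∃ V ⊆ U, IsOpen V ∧ x ∈ V ∧ ∃ k : X → G, ContinuousOn k V ∧
      ∀ m, f m ∈ K.t.range → K.t (k m) = f m := by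
  obtain ⟨W, hW, hxW, s, hs, hsec⟩ := hG ⟨f x, hr x hx⟩
  obtain ⟨W', hW', rfl⟩ := isOpen_induced_iff.1 hW
  obtain ⟨k, hk, hk1, hk2⟩ := exists_continuousOn_extension (s := U ∩ f ⁻¹' W')
    (fun m => s ⟨⟨f m, hr m m.2.1⟩, m.2.2⟩)
    (hs.comp (Continuous.subtype_mk (Continuous.subtype_mk
      (hf.mono Set.inter_subset_left).domRestrict _) _))
    -- The default value is still a preimage under `t` whenever one exists, so the lifting equation
    -- is not confined to the neighbourhood.
    (fun m => Function.invFun K.t (f m))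
  refine ⟨_, Set.inter_subset_left, hf.isOpen_inter_preimage hU hW', ⟨hx, hxW⟩, k, hk,
    fun m hm => ?_⟩
  by_cases h : m ∈ U ∩ f ⁻¹' W'
  · rw [hk1 m h]
    exact congrArg Subtype.val (hsec ⟨⟨f m, hr m h.1⟩, h.2⟩)
  · rw [hk2 m h]
    exact Function.invFun_eq hm

/-- The sections `[q x, 1]` of an extension. -/
abbrev extendSection (K : CrossedModule H G) {Q : PrincipalBundle K.G₁ M} {q : M → M → Q.total}
    (hq : ∀ x m, Q.proj (q x m) = m) : M → M → (K.extend Q).total :=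
  PrincipalBundle.contractedSection (K.leftMul M) hq
    PrincipalBundle.trivial_sectionData.proj

/-- On the unit section of M × G, left and right multiplication by an element of `G₁` coincide, so θ
is the transition function of `Q` itself. -/
theorem extend_sectionData {Q : PrincipalBundle K.G₁ M} {U : M → Set M} {q : M → M → Q.total}
    {a : M → M → M → K.G₁} (hq : Q.SectionData U q a) :
    (K.extend Q).SectionData U (K.extendSection hq.proj) fun x y m => a x y m := by
  have h := hq.contracted (L := K.leftMul M) (θ := fun x y m => a x y m)
    (PrincipalBundle.trivial_sectionData.mono hq.cover fun _ => Set.subset_univ _)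
    fun x y m => Prod.ext rfl ((mul_one _).trans (one_mul _).symm)
  simp only [mul_one] at h
  exact h

theorem str_extendSection {Q : PrincipalBundle K.G₁ M} {q : M → M → Q.total}
    (hq : ∀ x m, Q.proj (q x m) = m) (x m : M) :
    (K.extend Q).str (K.extendSection hq x m) = 1 :=
  map_one K.t

theorem extend_congr {Q R : PrincipalBundle K.G₁ M} (h : Q.IsIso R) :
    (K.extend Q).IsIso (K.extend R) := by
  obtain ⟨U, q, a, hq⟩ := Q.exists_sectionData
  obtain ⟨f, hf, hfa⟩ := h
  exact Bibundle.isIso_of_sectionData (extend_sectionData hq)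
    (extend_sectionData (hq.map f hf hfa)) fun x m => by rw [str_extendSection, str_extendSection]

theorem extend_trivial :
    (K.extend (PrincipalBundle.trivial K.G₁ M)).IsIso (Bibundle.trivial K M) :=
  Bibundle.isIso_of_sectionData
    (extend_sectionData (PrincipalBundle.trivial_sectionData (G := K.G₁) (M := M)))
    Bibundle.trivial_sectionData fun x m => by
      rw [str_extendSection, Bibundle.str_unitSection]

/-- The sections [r, 1] have structure function 1, so the twist by α disappears from the product
formula and the transition functions just multiply. -/
theorem extend_tensor (Q R : PrincipalBundle K.G₁ M) :
    (K.extend (Q.tensor R)).IsIso ((K.extend Q).tensor (K.extend R)) := by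
  obtain ⟨U, q, a, hq⟩ := Q.exists_sectionData
  obtain ⟨V, r, b, hr⟩ := R.exists_sectionData
  have hW := hq.cover.inter hr.cover
  replace hq := hq.mono hW fun _ => Set.inter_subset_left
  replace hr := hr.mono hW fun _ => Set.inter_subset_right
  have ht : (Q.tensor R).SectionData _ _ _ :=
    hq.contracted (L := R.abelianLeftAction) (θ := a) hr fun _ _ _ => rfl
  have h1 := extend_sectionData ht
  have h2 := Bibundle.tensor_sectionData (extend_sectionData hq) (extend_sectionData hr)
  refine Bibundle.isIso_of_sectionData h1
    (q := Bibundle.tensorSection (extend_sectionData hq).proj (extend_sectionData hr).proj)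
    ?_ fun x m => ?_
  · convert h2 using 1
    funext x y m
    rw [str_extendSection, inv_one, map_one, MulAut.one_apply]
    rfl
  · refine (str_extendSection ht.proj x m).trans ?_
    rw [Bibundle.str_tensorSection, str_extendSection, str_extendSection,
      one_mul]

theorem typeMap_extend (Q : PrincipalBundle K.G₁ M) : (K.extend Q).typeMap = 1 := by
  obtain ⟨U, q, a, hq⟩ := Q.exists_sectionData
  ext m
  rw [(K.extend Q).typeMap_eq ((extend_sectionData hq).proj m m), str_extendSection]
  rfl

/-- Write f([q_x, 1]) = [r_x, 1] k_x. Both sections have structure function 1 and f preserves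
structure maps, so t(k_x) = 1. Hence the r_x k_x are sections of `R` itself, with the transition
functions of `Q`. -/
theorem isIso_of_extend_isIso {Q R : PrincipalBundle K.G₁ M}
    (h : (K.extend Q).IsIso (K.extend R)) : Q.IsIso R := by
  obtain ⟨U, q, a, hq⟩ := Q.exists_sectionData
  obtain ⟨V, r, b, hr⟩ := R.exists_sectionData
  have hW := hq.cover.inter hr.cover
  replace hq := hq.mono hW fun _ => Set.inter_subset_left
  replace hr := hr.mono hW fun _ => Set.inter_subset_right
  obtain ⟨f, hf, hfa, hfs⟩ := h
  have h1 := (extend_sectionData hq).map f hf hfa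
  have h2 := extend_sectionData hr
  let k : M → M → G := fun x m =>
    (K.extend R).div (K.extendSection hr.proj x m) (f (K.extendSection hq.proj x m))
  have hk : ∀ x m, f (K.extendSection hq.proj x m) =
      (K.extend R).act (K.extendSection hr.proj x m) (k x m) := fun x m =>
    ((K.extend R).act_div (by rw [h2.proj, h1.proj])).symm
  have hkt : ∀ x m, k x m ∈ K.G₁ := fun x m => by
    have := congrArg (K.extend R).str (hk x m)
    rw [hfs, (K.extend R).str_act, str_extendSection, str_extendSection, one_mul] at this
    exact this.symm
  have hkc : ∀ x, ContinuousOn (k x) (U x ∩ V x) := fun x =>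
    (K.extend R).continuousOn_div.comp ((h2.cont x).prodMk (h1.cont x)) fun m _ =>
      (h2.proj x m).trans (h1.proj x m).symm
  refine hq.isIso (q := fun x m => R.act (r x m) ⟨k x m, hkt x m⟩) ?_
  convert hr.act (k := fun x m => ⟨k x m, hkt x m⟩)
    (fun x => continuousOn_subtype_mk (hkc x)) using 1
  funext x y m
  refine Subtype.ext ((K.extend R).act_injective (f (K.extendSection hq.proj x m)) ?_)
  rw [← h1.trans, hk y, hk x, h2.trans x y, ← (K.extend R).act_mul, ← (K.extend R).act_mul]
  congr 1
  simp [mul_assoc]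

/-- Trivial type puts ψ(p_x) in t(G). With local lifts k_x to `G`, the sections p_x k_x⁻¹ have
structure function 1; their transition functions therefore lie in ker t and define the `G₁`-bundle.
-/
theorem exists_isIso_extend (hG : HasLocalSections K.t.rangeRestrict) {P : Bibundle K M}
    (hP : P.typeMap = 1) : ∃ Q : PrincipalBundle K.G₁ M, P.IsIso (K.extend Q) := by
  obtain ⟨U, p, g, hp⟩ := P.exists_sectionData
  have hr : ∀ x m, P.str (p x m) ∈ K.t.range := fun x m => by
    rw [← QuotientGroup.eq_one_iff, ← P.typeMap_eq (hp.proj x m), hP]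
    rfl
  choose V hVU hV hxV k hk hkt using fun x => exists_local_lift hG (hp.cover.isOpen x)
    (hp.cover.mem x) (P.continuous_str.comp_continuousOn (hp.cont x)) fun m _ => hr x m
  have h1 := (hp.mono (fun x => ⟨hV x, hxV x⟩) hVU).act (k := fun x m => (k x m)⁻¹) fun x => (hk x).inv
  have hs : ∀ x m, P.str (P.act (p x m) (k x m)⁻¹) = 1 := fun x m => by
    rw [P.str_act, map_inv, hkt x m (hr x m)]
    exact mul_inv_cancel _
  obtain ⟨a, ha⟩ : ∃ a : M → M → M → K.G₁, ∀ x y m,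
      (a x y m : G) = ((k x m)⁻¹)⁻¹ * g x y m * (k y m)⁻¹ := by
    refine ⟨fun x y m => ⟨_, ?_⟩, fun _ _ _ => rfl⟩
    have := P.str_trans h1 x y m
    rw [hs, hs, one_mul] at this
    exact this.symm
  simp only [← ha] at h1
  obtain ⟨Q, q, hq⟩ := PrincipalBundle.exists_of_cocycle V a h1.cover
    (fun x y => continuousOn_subtype_mk (h1.cont_trans x y))
    fun x y z m => Subtype.ext (h1.trans_mul x y z m)
  exact ⟨Q, Bibundle.isIso_of_sectionData h1 (extend_sectionData hq) fun x m => by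
    rw [str_extendSection, hs]⟩

theorem typeMap_eq_one_iff (hG : HasLocalSections K.t.rangeRestrict) (P : Bibundle K M) :
    P.typeMap = 1 ↔ ∃ Q : PrincipalBundle K.G₁ M, P.IsIso (K.extend Q) := by
  refine ⟨exists_isIso_extend hG, ?_⟩
  rintro ⟨Q, h⟩
  rw [h.typeMap_eq, typeMap_extend]

end CrossedModule

end Bibundles

/-! ### Comparison of Čech classes. -/

namespace Cech

variable {M A : Type u} [TopologicalSpace M] [CommGroup A] [TopologicalSpace A]
  [IsTopologicalGroup A]

theorem H2.mk_eq_mk {c d : cocycles M A} {U : M → Set M} (hU : IsPointedCover U)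
    {b : M → M → M → A} (hb : ∀ x y, ContinuousOn (b x y) (U x ∩ U y))
    (h : ∀ x y z m, m ∈ U x → m ∈ U y → m ∈ U z →
      d.1 x y z m = c.1 x y z m * (b y z m * (b x z m)⁻¹ * b x y m)) :
    H2.mk c = H2.mk d := by
  refine QuotientGroup.eq.2 (Subgroup.mem_subgroupOf.2 ⟨U, hU, b, hb, fun x y z m hx hy hz => ?_⟩)
  change (c.1 x y z m)⁻¹ * d.1 x y z m = _
  rw [h x y z m hx hy hz, inv_mul_cancel_left]

theorem H2.exists_of_mk_eq_one {c : cocycles M A} (h : H2.mk c = 1) :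
    ∃ U : M → Set M, IsPointedCover U ∧ ∃ b : M → M → M → A,
      (∀ x y, ContinuousOn (b x y) (U x ∩ U y)) ∧
      ∀ x y z m, m ∈ U x → m ∈ U y → m ∈ U z →
        c.1 x y z m = b y z m * (b x z m)⁻¹ * b x y m :=
  Subgroup.mem_subgroupOf.1 ((QuotientGroup.eq_one_iff c).1 h)

end Cech

/-! ### Local lifts of a map and the class of its lifting gerbe. -/

section Gerbes

variable {H G M : Type u} [Group H] [TopologicalSpace H] [IsTopologicalGroup H]
  [Group G] [TopologicalSpace G] [IsTopologicalGroup G] [TopologicalSpace M]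
  {K : CrossedModule H G}

namespace CrossedModule

/-- Lifts `s x` of a map `φ` to `H`, continuous on the sets of a pointed cover, together with lifts
`g x y` to `G` of their differences. Away from the cover the lifts are only set-theoretic. -/
structure LiftData (K : CrossedModule H G) (φ : C(M, K.Out)) (U : M → Set M) (s : M → M → H)
    (g : M → M → M → G) : Prop where
  cover : Cech.IsPointedCover U
  cont_lift : ∀ x, ContinuousOn (s x) (U x)
  cont_trans : ∀ x y, ContinuousOn (g x y) (U x ∩ U y)
  mk_lift : ∀ x m, (QuotientGroup.mk (s x m) : K.Out) = φ m
  t_trans : ∀ x y m, K.t (g x y m) = (s x m)⁻¹ * s y m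

namespace LiftData

variable {φ φ' : C(M, K.Out)} {U U' : M → Set M} {s s' : M → M → H} {g g' : M → M → M → G}

/-- The failure of the transition functions `g` to be a cocycle. -/
def defect (h : K.LiftData φ U s g) (x y z m : M) : K.G₁ :=
  ⟨(g x z m)⁻¹ * (g x y m * g y z m), by
    rw [MonoidHom.mem_ker, map_mul, map_mul, map_inv, h.t_trans, h.t_trans, h.t_trans]
    group⟩

theorem trans_mul (h : K.LiftData φ U s g) (x y z m : M) :
    g x y m * g y z m = g x z m * h.defect x y z m :=
  (mul_inv_cancel_left _ _).symm

theorem defect_eq (h : K.LiftData φ U s g) {x y z m : M} {a : K.G₁}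
    (ha : g x y m * g y z m = g x z m * a) : h.defect x y z m = a :=
  Subtype.ext (mul_left_cancel ((h.trans_mul x y z m).symm.trans ha))

/-- Evaluate g_wx g_xy g_yz with both bracketings; centrality of `G₁` lets the defects be moved to
the right. -/
theorem defect_mul (h : K.LiftData φ U s g) (w x y z m : M) :
    h.defect w y z m * h.defect w x y m = h.defect w x z m * h.defect x y z m := by
  refine Subtype.ext (mul_left_cancel (a := g w z m) ?_)
  calc g w z m * (h.defect w y z m * h.defect w x y m : G)
      = g w y m * g y z m * h.defect w x y m := by rw [h.trans_mul w y z, mul_assoc]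
    _ = g w x m * g x y m * g y z m := by
      rw [h.trans_mul w x y, mul_assoc, mul_assoc, K.G₁_central]
    _ = g w z m * (h.defect w x z m * h.defect x y z m : G) := by
      rw [mul_assoc, h.trans_mul x y z, ← mul_assoc, h.trans_mul w x z, mul_assoc]

/-- The Čech cocycle of the transition functions `g`. -/
def cocycle (h : K.LiftData φ U s g) : Cech.cocycles M K.G₁ :=
  ⟨h.defect, U, h.cover, fun x y z => by
    refine continuousOn_subtype_mk (ContinuousOn.mul (ContinuousOn.inv ?_) (ContinuousOn.mul ?_ ?_))
    · exact (h.cont_trans x z).mono fun m hm => ⟨hm.1.1, hm.2⟩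
    · exact (h.cont_trans x y).mono fun m hm => hm.1
    · exact (h.cont_trans y z).mono fun m hm => ⟨hm.1.2, hm.2⟩,
    fun w x y z m _ _ _ _ => by
      have := h.defect_mul w x y z m
      calc _ = (h.defect w x z m * h.defect x y z m) *
            (h.defect w y z m * h.defect w x y m)⁻¹ := by rw [mul_inv_rev]; ac_rfl
        _ = 1 := by rw [this, mul_inv_cancel]⟩

/-- Nothing changes over the cover. When r selects indices whose sets contain the point, identities
known only over the cover become valid everywhere. -/
theorem reindex {r : M → M → M} (h : K.LiftData φ U s g) (hr : ∀ x, ∀ m ∈ U x, r x m = x) :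
    K.LiftData φ U (fun x m => s (r x m) m) fun x y m => g (r x m) (r y m) m where
  cover := h.cover
  cont_lift x := (h.cont_lift x).congr fun m hm => by rw [hr x m hm]
  cont_trans x y := (h.cont_trans x y).congr fun m hm => by rw [hr x m hm.1, hr y m hm.2]
  mk_lift _ _ := h.mk_lift _ _
  t_trans _ _ _ := h.t_trans _ _ _

theorem mono {V : M → Set M} (h : K.LiftData φ U s g) (hV : Cech.IsPointedCover V)
    (hVU : ∀ x, V x ⊆ U x) : K.LiftData φ V s g :=
  ⟨hV, fun x => (h.cont_lift x).mono (hVU x),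
    fun x y => (h.cont_trans x y).mono (Set.inter_subset_inter (hVU x) (hVU y)),
    h.mk_lift, h.t_trans⟩

theorem mul_central (h : K.LiftData φ U s g) {b : M → M → M → K.G₁}
    (hb : ∀ x y, ContinuousOn (b x y) (U x ∩ U y)) :
    K.LiftData φ U s fun x y m => g x y m * b x y m :=
  ⟨h.cover, h.cont_lift,
    fun x y => (h.cont_trans x y).mul (continuous_subtype_val.comp_continuousOn (hb x y)),
    h.mk_lift, fun x y m => by
      rw [map_mul, show K.t (b x y m) = 1 from (b x y m).2, mul_one, h.t_trans]⟩

/-- If the cocycle of the lifts is a coboundary, then the lifts may be corrected so as to satisfy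
the cocycle identity. -/
theorem exists_cocycle (h : K.LiftData φ U s g) (h1 : Cech.H2.mk h.cocycle = 1) :
    ∃ V s' g', K.LiftData φ V s' g' ∧ ∀ x y z m, g' x y m * g' y z m = g' x z m := by
  obtain ⟨V, hV, b, hb, hd⟩ := Cech.H2.exists_of_mk_eq_one h1
  have hW := h.cover.inter hV
  obtain ⟨r, hr, hr'⟩ := hW.exists_reindex
  -- The defect is the coboundary of b, and multiplying g by the central b⁻¹ cancels it. Reindexing
  -- is needed because the coboundary equation holds only over the cover.
  refine ⟨_, _, _, ((h.mono hW fun _ => Set.inter_subset_left).mul_central (b := b⁻¹)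
    fun x y => ((hb x y).mono fun m hm => ⟨hm.1.2, hm.2.2⟩).inv).reindex hr',
    fun x y z m => ?_⟩
  have h2 := hd _ _ _ m (hr x m).2 (hr y m).2 (hr z m).2
  generalize r x m = x' at *
  generalize r y m = y' at *
  generalize r z m = z' at *
  have h3 : ((b x' y' m)⁻¹ * (b y' z' m)⁻¹ : K.G₁) = (h.defect x' y' z' m)⁻¹ * (b x' z' m)⁻¹ := by
    rw [show h.defect x' y' z' m = _ from h2]
    simp only [mul_inv_rev, inv_inv]
    rw [mul_assoc, mul_assoc, mul_comm (b x' z' m), mul_assoc, inv_mul_cancel, mul_one]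
  calc g x' y' m * ((b x' y' m)⁻¹ : K.G₁) * (g y' z' m * ((b y' z' m)⁻¹ : K.G₁))
      = g x' y' m * g y' z' m * (((b x' y' m)⁻¹ * (b y' z' m)⁻¹ : K.G₁) : G) := by
        rw [mul_assoc, ← mul_assoc (((b x' y' m)⁻¹ : K.G₁) : G), K.G₁_central, Subgroup.coe_mul]
        simp only [mul_assoc]
    _ = g x' z' m * ((b x' z' m)⁻¹ : K.G₁) := by
        rw [h3, h.trans_mul, Subgroup.coe_mul, mul_assoc, ← mul_assoc (h.defect x' y' z' m : G),
          Subgroup.coe_inv (K.G₁) (h.defect x' y' z' m), mul_inv_cancel, one_mul]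

/-- Over a finer cover, s_x⁻¹ s'_x lifts to some k_x in `G`. Then g'_xy and k_x⁻¹ g_xy k_y have the
same image under t, so they differ by a central b_xy. The gauge change by k leaves the central
defect alone, and b changes it by a coboundary. -/
theorem mk_cocycle_eq (hG : HasLocalSections K.t.rangeRestrict) (h : K.LiftData φ U s g)
    (h' : K.LiftData φ U' s' g') : Cech.H2.mk h.cocycle = Cech.H2.mk h'.cocycle := by
  have hW := h.cover.inter h'.cover
  have hr : ∀ x m, (s x m)⁻¹ * s' x m ∈ K.t.range := fun x m =>
    QuotientGroup.eq.1 ((h.mk_lift x m).trans (h'.mk_lift x m).symm)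
  choose V hVW hV hxV k hk hkt using fun x => exists_local_lift hG (hW.isOpen x) (hW.mem x)
    (f := fun m => (s x m)⁻¹ * s' x m)
    (((h.cont_lift x).mono Set.inter_subset_left).inv.mul
      ((h'.cont_lift x).mono Set.inter_subset_right)) fun m _ => hr x m
  have hkt' : ∀ x m, K.t (k x m) = (s x m)⁻¹ * s' x m := fun x m => hkt x m (hr x m)
  obtain ⟨b, hb⟩ : ∃ b : M → M → M → K.G₁, ∀ x y m,
      (b x y m : G) = (k y m)⁻¹ * (g x y m)⁻¹ * k x m * g' x y m := by
    refine ⟨fun x y m => ⟨_, ?_⟩, fun _ _ _ => rfl⟩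
    simp only [MonoidHom.mem_ker, map_mul, map_inv, hkt', h.t_trans, h'.t_trans]
    group
  have hg' : ∀ x y m, g' x y m = (k x m)⁻¹ * g x y m * k y m * b x y m := fun x y m => by
    rw [hb]; group
  refine Cech.H2.mk_eq_mk (U := V) (fun x => ⟨hV x, hxV x⟩) (b := b)
    (fun x y => continuousOn_subtype_mk ?_) fun x y z m _ _ _ => h'.defect_eq ?_
  · simp only [hb]
    have hx := (hk x).mono (Set.inter_subset_left (t := V y))
    have hy := (hk y).mono (Set.inter_subset_right (s := V x))
    exact ((hy.inv.mul ((h.cont_trans x y).mono fun m hm => ⟨(hVW x hm.1).1, (hVW y hm.2).1⟩).inv).mul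
      hx).mul ((h'.cont_trans x y).mono fun m hm => ⟨(hVW x hm.1).2, (hVW y hm.2).2⟩)
  · change _ = g' x z m * ((h.defect x y z m *
      (b y z m * (b x z m)⁻¹ * b x y m) : K.G₁) : G)
    have h1 : (b x z m : K.G₁) * (h.defect x y z m * (b y z m * (b x z m)⁻¹ * b x y m)) =
        h.defect x y z m * (b x y m * b y z m) := by
      calc _ = h.defect x y z m * (b x y m * b y z m) * (b x z m * (b x z m)⁻¹) := by ac_rfl
        _ = _ := by rw [mul_inv_cancel, mul_one]
    rw [hg' x z, mul_assoc _ (b x z m : G), ← Subgroup.coe_mul, h1, hg' x y, hg' y z]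
    have h2 := h.trans_mul x y z m
    calc (k x m)⁻¹ * g x y m * k y m * b x y m * ((k y m)⁻¹ * g y z m * k z m * b y z m)
        = (k x m)⁻¹ * g x y m * k y m * (b x y m * ((k y m)⁻¹ * g y z m * k z m)) * b y z m := by
          group
      _ = (k x m)⁻¹ * (g x y m * g y z m) * k z m * (b x y m * b y z m) := by
          rw [K.G₁_central]; group
      _ = (k x m)⁻¹ * g x z m * (h.defect x y z m * k z m) * (b x y m * b y z m) := by
          rw [h2]; group
      _ = (k x m)⁻¹ * g x z m * k z m * (h.defect x y z m * (b x y m * b y z m) : K.G₁) := by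
          rw [K.G₁_central]; simp only [mul_assoc, Subgroup.coe_mul]

theorem mul (h : K.LiftData φ U s g) (h' : K.LiftData φ' U' s' g') :
    K.LiftData (φ * φ') (fun x => U x ∩ U' x) (fun x m => s x m * s' x m)
      fun x y m => K.α (s' x m)⁻¹ (g x y m) * g' x y m where
  cover := h.cover.inter h'.cover
  cont_lift x := ((h.cont_lift x).mono Set.inter_subset_left).mul
    ((h'.cont_lift x).mono Set.inter_subset_right)
  cont_trans x y := by
    refine ContinuousOn.mul ?_ ((h'.cont_trans x y).mono fun m hm => ⟨hm.1.2, hm.2.2⟩)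
    exact K.continuous_α.comp_continuousOn
      ((((h'.cont_lift x).mono fun m hm => hm.1.2).inv).prodMk
        ((h.cont_trans x y).mono fun m hm => ⟨hm.1.1, hm.2.1⟩))
  mk_lift x m := by rw [QuotientGroup.mk_mul, h.mk_lift, h'.mk_lift]; rfl
  t_trans x y m := by
    rw [map_mul, K.t_α, h.t_trans, h'.t_trans]
    group

/-- The identity already holds for cocycles. Since s'_y = s'_x t(g'_xy), α(s'_y)⁻¹ is α(s'_x)⁻¹
followed by conjugation by g'_xy⁻¹. The conjugation cancels in the product, leaving the two defects,
the first one moved by α(s'_x)⁻¹; on `G₁` this is the action of φ'⁻¹. -/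
theorem mul_cocycle (h : K.LiftData φ U s g) (h' : K.LiftData φ' U' s' g') :
    Cech.H2.mk (h.mul h').cocycle =
      K.twist φ'⁻¹ (Cech.H2.mk h.cocycle) * Cech.H2.mk h'.cocycle := by
  refine congrArg Cech.H2.mk (Subtype.ext ?_)
  funext x y z m
  refine (h.mul h').defect_eq ?_
  have h1 : K.outAct (φ'⁻¹ m) (h.defect x y z m) = K.αG₁ (s' x m)⁻¹ (h.defect x y z m) := by
    rw [ContinuousMap.inv_apply, ← h'.mk_lift x m]
    rfl
  change _ = _ * ((K.outAct (φ'⁻¹ m) (h.defect x y z m) * h'.defect x y z m : K.G₁) : G)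
  rw [h1]
  have h2 : (s' y m)⁻¹ = K.t (g' x y m)⁻¹ * (s' x m)⁻¹ := by
    rw [map_inv, h'.t_trans]; group
  rw [h2, map_mul K.α, MulAut.mul_apply, K.α_t]
  change _ = _ * (K.α (s' x m)⁻¹ (h.defect x y z m) * (h'.defect x y z m : G))
  have h3 := K.G₁_central ⟨_, K.α_mem_G₁ (s' x m)⁻¹ (h.defect x y z m)⟩ (g' x z m)
  calc K.α (s' x m)⁻¹ (g x y m) * g' x y m *
        ((g' x y m)⁻¹ * K.α (s' x m)⁻¹ (g y z m) * (g' x y m)⁻¹⁻¹ * g' y z m)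
      = K.α (s' x m)⁻¹ (g x y m) * K.α (s' x m)⁻¹ (g y z m) * (g' x y m * g' y z m) := by group
    _ = K.α (s' x m)⁻¹ (g x z m) * (K.α (s' x m)⁻¹ (h.defect x y z m) * g' x z m) *
        h'.defect x y z m := by
      rw [← map_mul, h.trans_mul, h'.trans_mul, map_mul]
      simp only [mul_assoc]
    _ = _ := by
      rw [show K.α (s' x m)⁻¹ (h.defect x y z m) * g' x z m = _ from h3]
      simp only [mul_assoc]

theorem isClass (hG : HasLocalSections K.t.rangeRestrict)
    (hH : HasLocalSections (QuotientGroup.mk : H → K.Out)) (h : K.LiftData φ U s g) :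
    (K.liftingGerbe hG hH φ).IsClass (Cech.H2.mk h.cocycle) := by
  let s₁ : M → M → K.Pullback φ := fun x m => ⟨(m, s x m), (h.mk_lift x m).symm⟩
  let σ : M → M → M → K.LiftingTotal φ := fun x y m =>
    ⟨(⟨(s₁ x m, s₁ y m), rfl⟩, g x y m), Subtype.ext (h.t_trans x y m)⟩
  have hs₁ : ∀ x, ContinuousOn (s₁ x) (U x) := fun x =>
    continuousOn_subtype_mk (continuousOn_id.prodMk (h.cont_lift x))
  refine ⟨U, h.cover, s₁, hs₁, fun _ _ _ => rfl, σ, fun x y => ?_, fun _ _ _ _ => rfl, h.cocycle,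
    fun x y z m _ _ => ?_, rfl⟩
  · exact continuousOn_subtype_mk ((continuousOn_subtype_mk
      (((hs₁ x).mono Set.inter_subset_left).prodMk ((hs₁ y).mono Set.inter_subset_right))).prodMk
        (h.cont_trans x y))
  · exact Subtype.ext (Prod.ext rfl (h.trans_mul x y z m))

end LiftData

/-- Sections of φ^*H are lifts of φ to `H`, and sections of the gerbe's bundle over overlaps are
lifts of their differences to `G`. So every computation of the class arises from lifting data. -/
theorem exists_liftData_of_isClass {hG : HasLocalSections K.t.rangeRestrict}
    {hH : HasLocalSections (QuotientGroup.mk : H → K.Out)} {φ : C(M, K.Out)}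
    {c : Cech.H2 M K.G₁} (hc : (K.liftingGerbe hG hH φ).IsClass c) :
    ∃ U s g, ∃ h : K.LiftData φ U s g, c = Cech.H2.mk h.cocycle := by
  obtain ⟨U, hU, s, hs, hsπ, σ, hσ, hσs, γ, hγ, rfl⟩ := hc
  change M → M → K.Pullback φ at s
  change M → M → M → K.LiftingTotal φ at σ
  replace hsπ : ∀ x, ∀ m ∈ U x, (s x m).1.1 = m := hsπ
  replace hσs : ∀ x y, ∀ m ∈ U x ∩ U y, (σ x y m).1.1.1 = (s x m, s y m) := hσs
  replace hγ : ∀ x y z m, m ∈ U x ∩ U y ∩ U z →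
      (σ x y m).1.2 * (σ y z m).1.2 = (σ x z m).1.2 * γ.1 x y z m := fun x y z m hm =>
    congrArg (fun w : K.LiftingTotal φ => w.1.2) (hγ x y z m hm (by
      change (σ x y m).1.1.1.2 = (σ y z m).1.1.1.1
      rw [hσs x y m hm.1, hσs y z m ⟨hm.1.2, hm.2⟩]))
  obtain ⟨r, hr, hr'⟩ := hU.exists_reindex
  have h : K.LiftData φ U (fun x m => (s (r x m) m).1.2)
      fun x y m => (σ (r x m) (r y m) m).1.2 := by
    refine ⟨hU, fun x => ?_, fun x y => ?_, fun x m => ?_, fun x y m => ?_⟩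
    · have h1 : ContinuousOn (fun m => (s x m).1.2) (U x) :=
        (continuous_snd.comp continuous_subtype_val).comp_continuousOn (hs x)
      exact h1.congr fun m hm => by rw [hr' x m hm]
    · have h1 : ContinuousOn (fun m => (σ x y m).1.2) (U x ∩ U y) :=
        (continuous_snd.comp continuous_subtype_val).comp_continuousOn (hσ x y)
      exact h1.congr fun m hm => by rw [hr' x m hm.1, hr' y m hm.2]
    · rw [← (s (r x m) m).2, hsπ _ _ (hr x m)]
    · have h1 := congrArg Subtype.val (σ (r x m) (r y m) m).2
      have h2 := hσs _ _ m ⟨hr x m, hr y m⟩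
      refine h1.trans ?_
      change ((σ (r x m) (r y m) m).1.1.1.1.1.2)⁻¹ * (σ (r x m) (r y m) m).1.1.1.2.1.2 = _
      rw [h2]
  -- The given cocycle and the defect need agree only over the cover; the class sees nothing else.
  refine ⟨U, _, _, h, Cech.H2.mk_eq_mk hU (b := 1) (fun _ _ => continuousOn_const)
    fun x y z m hx hy hz => h.defect_eq ?_⟩
  simpa only [hr' x m hx, hr' y m hy, hr' z m hz, Pi.one_apply, inv_one, mul_one] using
    hγ x y z m ⟨⟨hx, hy⟩, hz⟩

/-- Lifting data satisfying the cocycle identity are exactly the local data of a bibundle of type φ.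
Conversely the transition functions of a bibundle have defect 1. -/
theorem isClass_one_iff (hG : HasLocalSections K.t.rangeRestrict)
    (hH : HasLocalSections (QuotientGroup.mk : H → K.Out)) (φ : C(M, K.Out)) :
    (K.liftingGerbe hG hH φ).IsClass 1 ↔ ∃ P : Bibundle K M, P.typeMap = φ := by
  constructor
  · intro h
    obtain ⟨U, s, g, hd, h1⟩ := exists_liftData_of_isClass h
    obtain ⟨V, s, g, hd, hc⟩ := hd.exists_cocycle h1.symm
    obtain ⟨P, p, hp, hps⟩ := Bibundle.exists_of_cocycle (K := K) hd.cover hd.cont_trans hc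
      hd.cont_lift fun x y m => by rw [hd.t_trans, mul_inv_cancel_left]
    refine ⟨P, ContinuousMap.ext fun m => ?_⟩
    rw [P.typeMap_eq (hp.proj m m), hps, hd.mk_lift]
  · rintro ⟨P, rfl⟩
    obtain ⟨U, p, g, hp⟩ := P.exists_sectionData
    have h : K.LiftData P.typeMap U (fun x m => P.str (p x m)) g :=
      ⟨hp.cover, fun x => P.continuous_str.comp_continuousOn (hp.cont x), hp.cont_trans,
        fun x m => (P.typeMap_eq (hp.proj x m)).symm,
        fun x y m => by rw [P.str_trans hp x y, inv_mul_cancel_left]⟩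
    convert h.isClass hG hH
    refine (congrArg Cech.H2.mk (Subtype.ext ?_ : h.cocycle = 1)).symm
    funext x y z m
    exact h.defect_eq ((hp.trans_mul x y z m).trans (mul_one _).symm)

/-- The difficulty is that s_x⁻¹ s_y must lift to `G` on a whole overlap, while `hG` lifts it only
near a point. Local finiteness leaves finitely many lifts s_j to compare near each x, so one
neighbourhood of x serves for all of them. -/
theorem exists_liftData [ParacompactSpace M] [T2Space M]
    (hG : HasLocalSections K.t.rangeRestrict)
    (hH : HasLocalSections (QuotientGroup.mk : H → K.Out)) (φ : C(M, K.Out)) :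
    ∃ U s g, K.LiftData φ U s g := by
  have hlift : ∀ x : M, ∃ W : Set M, IsOpen W ∧ x ∈ W ∧ ∃ s : M → H, ContinuousOn s W ∧
      ∀ m, (QuotientGroup.mk (s m) : K.Out) = φ m := fun x => by
    obtain ⟨V, hV, hx, s, hs, hsec⟩ := hH (φ x)
    obtain ⟨s', hs', h1, h2⟩ := exists_continuousOn_extension (s := φ ⁻¹' V)
      (fun m => s ⟨φ m, m.2⟩)
      (hs.comp (Continuous.subtype_mk (φ.continuous.comp continuous_subtype_val) _))
      fun m => (φ m).out
    refine ⟨φ ⁻¹' V, hV.preimage φ.continuous, hx, s', hs', fun m => ?_⟩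
    by_cases hm : m ∈ φ ⁻¹' V
    · rw [h1 m hm]; exact hsec _
    · rw [h2 m hm]; exact QuotientGroup.out_eq' _
  choose W hW hxW s hs hsφ using hlift
  obtain ⟨v, hv, hvU, hvf, hvW⟩ := precise_refinement W hW
    (Set.eq_univ_of_forall fun x => Set.mem_iUnion.2 ⟨x, hxW x⟩)
  -- Shrinking gives the dichotomy used below: either x lies in the closure of w_j, hence in v_j
  -- where s_j is continuous, or a neighbourhood of x misses w_j.
  obtain ⟨w, hwU, hw, hwv⟩ := exists_iUnion_eq_closure_subset hv
    (fun x => hvf.point_finite x) hvU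
  have hwf : LocallyFinite w := hvf.subset fun i => subset_closure.trans (hwv i)
  choose i hi using fun x => Set.mem_iUnion.1 (hwU.ge (Set.mem_univ x))
  have hr : ∀ a b m, (s a m)⁻¹ * s b m ∈ K.t.range := fun a b m =>
    QuotientGroup.eq.1 ((hsφ a m).trans (hsφ b m).symm)
  -- over a neighbourhood of `x`, each difference of lifts on `w j` lifts to `G`
  have hloc : ∀ x j, ∃ N ∈ 𝓝 x, ∃ k : M → G, ContinuousOn k (N ∩ w j) ∧
      ∀ m, K.t (k m) = (s (i x) m)⁻¹ * s j m := fun x j => by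
    by_cases hx : x ∈ closure (w j)
    · obtain ⟨V, -, hV, hxV, k, hk, hkt⟩ := exists_local_lift hG
        (f := fun m => (s (i x) m)⁻¹ * s j m) ((hv (i x)).inter (hv j))
        ⟨hwv _ (subset_closure (hi x)), hwv j hx⟩
        (((hs _).mono fun m hm => hvW _ hm.1).inv.mul ((hs _).mono fun m hm => hvW _ hm.2))
        fun m _ => hr _ _ m
      exact ⟨V, hV.mem_nhds hxV, k, hk.mono Set.inter_subset_left, fun m => hkt m (hr _ _ m)⟩
    · refine ⟨(closure (w j))ᶜ, isClosed_closure.isOpen_compl.mem_nhds hx,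
        -- Any set-theoretic lift will do, as continuity is required on an empty set.
        fun m => Function.invFun K.t ((s (i x) m)⁻¹ * s j m), ?_,
        fun m => Function.invFun_eq (hr (i x) j m)⟩
      rw [(disjoint_compl_left.mono_right subset_closure : Disjoint (closure (w j))ᶜ (w j)).inter_eq]
      exact continuousOn_empty _
  choose N hN k hk hkt using hloc
  have hV : ∀ x, {m | m ∈ w (i x) ∧ ∀ j, m ∈ w j → m ∈ N x j} ∈ 𝓝 x := fun x => by
    obtain ⟨T, hT, hfin⟩ := hwf x
    filter_upwards [(hw (i x)).mem_nhds (hi x), hT,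
      (Filter.biInter_mem hfin).2 fun j _ => hN x j] with m hm hmT hmN
    exact ⟨hm, fun j hj => Set.mem_iInter₂.1 hmN j ⟨m, hj, hmT⟩⟩
  choose V hVs hV hxV using fun x => mem_nhds_iff.1 (hV x)
  -- The lift over V_x ∩ V_y is the one chosen near x for the index of y: a point of V_y lies in
  -- w_{i(y)}, and a point of V_x lying there also lies in the neighbourhood where that lift is
  -- continuous.
  refine ⟨V, fun x => s (i x), fun x y => k x (i y), fun x => ⟨hV x, hxV x⟩, fun x => ?_,
    fun x y => ?_, fun x m => hsφ _ _, fun x y m => hkt _ _ _⟩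
  · exact (hs (i x)).mono fun m hm => hvW _ (hwv _ (subset_closure (hVs x hm).1))
  · exact (hk x (i y)).mono fun m hm => ⟨(hVs x hm.1).2 _ (hVs y hm.2).1, (hVs y hm.2).1⟩

end CrossedModule

end Gerbes

/-! ### The exact sequence on isomorphism classes. -/

section Sequence

variable {H G M : Type u} [Group H] [TopologicalSpace H] [IsTopologicalGroup H]
  [Group G] [TopologicalSpace G] [IsTopologicalGroup G] [TopologicalSpace M]
  {K : CrossedModule H G}

namespace Bibundle

/-- The map induced on isomorphism classes by `Type`. -/
noncomputable def classType (K : CrossedModule H G) (M : Type u) [TopologicalSpace M] :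
    letI := classGroup K M
    Bibun₀ K M →* C(M, K.Out) :=
  letI := classGroup K M
  { toFun := Quotient.lift typeMap fun _ _ h => IsIso.typeMap_eq h
    map_one' := typeMap_trivial
    map_mul' := fun a b => Quotient.inductionOn₂ a b typeMap_tensor }

end Bibundle

namespace CrossedModule

/-- The map induced on isomorphism classes by the extension of bundles. -/
def classExtend (K : CrossedModule H G) (M : Type u) [TopologicalSpace M] :
    Bun₀ K.G₁ M → Bibun₀ K M :=
  Quotient.map (sa := PrincipalBundle.isoSetoid K.G₁ M) (sb := Bibundle.isoSetoid K M)
    K.extend fun _ _ h => extend_congr h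

theorem classExtend_injective : Function.Injective (K.classExtend M) := fun a b =>
  Quotient.inductionOn₂ a b fun _ _ h =>
    Quotient.sound (isIso_of_extend_isIso (Quotient.exact h))

theorem exists_classExtend_eq_iff (hG : HasLocalSections K.t.rangeRestrict) (z : Bibun₀ K M) :
    letI := Bibundle.classGroup K M
    (∃ a, K.classExtend M a = z) ↔ z ∈ (Bibundle.classType K M).ker := by
  induction z using Quotient.inductionOn with
  | h P =>
    refine Iff.trans ⟨?_, ?_⟩ (typeMap_eq_one_iff hG P).symm
    · rintro ⟨a, ha⟩
      induction a using Quotient.inductionOn with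
      | h Q => exact ⟨Q, (Bibundle.isoSetoid K M).symm (Quotient.exact ha)⟩
    · rintro ⟨Q, h⟩
      exact ⟨Q.cls, (Quotient.sound h).symm⟩

/-- Extension identifies the isomorphism classes of `G₁`-bundles with the bibundles of trivial
type. -/
noncomputable def classExtendEquiv (hG : HasLocalSections K.t.rangeRestrict) :
    letI := Bibundle.classGroup K M
    Bun₀ K.G₁ M ≃ (Bibundle.classType K M).ker :=
  letI := Bibundle.classGroup K M
  Equiv.ofBijective
    (fun a => ⟨K.classExtend M a, (exists_classExtend_eq_iff hG _).1 ⟨a, rfl⟩⟩)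
    ⟨fun _ _ h => classExtend_injective (congrArg Subtype.val h), fun z =>
      ((exists_classExtend_eq_iff hG _).2 z.2).imp fun _ h => Subtype.ext h⟩

end CrossedModule

end Sequence

theorem mainTheorem6 {M H G : Type u} [TopologicalSpace M]
    [Group H] [TopologicalSpace H] [IsTopologicalGroup H]
    [Group G] [TopologicalSpace G] [IsTopologicalGroup G]
    (K : CrossedModule H G)
    (hG : HasLocalSections K.t.rangeRestrict)
    (hH : HasLocalSections (QuotientGroup.mk : H → K.Out)) :
    ∃ (_ : Group (Bun₀ K.G₁ M)) (_ : Group (Bibun₀ K M)),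
      -- the group structures are those given by the product of bundles
      ((1 : Bun₀ K.G₁ M) = (PrincipalBundle.trivial K.G₁ M).cls ∧
        ∀ Q R : PrincipalBundle K.G₁ M, Q.cls * R.cls = (Q.tensor R).cls) ∧
      ((1 : Bibun₀ K M) = (Bibundle.trivial K M).cls ∧
        ∀ P Q : Bibundle K M, P.cls * Q.cls = (P.tensor Q).cls) ∧
      ∃ (ι : Bun₀ K.G₁ M →* Bibun₀ K M) (T : Bibun₀ K M →* C(M, K.Out)),
        (∀ Q : PrincipalBundle K.G₁ M, ι Q.cls = (K.extend Q).cls) ∧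
        (∀ P : Bibundle K M, T P.cls = P.typeMap) ∧
        Function.Injective ι ∧
        ι.range = T.ker ∧
        (∀ Q : PrincipalBundle K.G₁ M, Q.IsIso (PrincipalBundle.trivial K.G₁ M) ↔
          (K.extend Q).IsIso (Bibundle.trivial K M)) ∧
        (∀ P : Bibundle K M, P.typeMap = 1 ↔
          ∃ Q : PrincipalBundle K.G₁ M, P.IsIso (K.extend Q)) ∧
        -- a map is a type map iff the class of its lifting bundle gerbe is trivial
        (∀ φ, φ ∈ T.range ↔ (K.liftingGerbe hG hH φ).IsClass 1) ∧
        -- on a paracompact base the class is defined for every map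
        (∀ [ParacompactSpace M] [T2Space M],
          ∃ ε : C(M, K.Out) → Cech.H2 M K.G₁,
            (∀ φ c, (K.liftingGerbe hG hH φ).IsClass c ↔ c = ε φ) ∧
            (∀ φ, φ ∈ T.range ↔ ε φ = 1) ∧
            ∀ φ φ', ε (φ * φ') = K.twist φ'⁻¹ (ε φ) * ε φ') := by
  
  let iB : Group (Bibun₀ K M) := Bibundle.classGroup K M
  let e := CrossedModule.classExtendEquiv (M := M) hG
  -- The group structure is transported from the kernel of the type map. Injectivity of ι and its
  -- compatibility with products then identify it with the product of `G₁`-bundles, without separate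
  -- group axioms.
  let iA : Group (Bun₀ K.G₁ M) := e.group
  let T := Bibundle.classType K M
  let ι : Bun₀ K.G₁ M →* Bibun₀ K M := T.ker.subtype.comp e.mulEquiv.toMonoidHom
  have hι : ∀ a, ι a = K.classExtend M a := fun _ => rfl
  have hinj : Function.Injective ι := CrossedModule.classExtend_injective
  have hone : (1 : Bun₀ K.G₁ M) = (PrincipalBundle.trivial K.G₁ M).cls :=
    hinj ((map_one ι).trans (Quotient.sound CrossedModule.extend_trivial).symm)
  have hT : ∀ φ, φ ∈ T.range ↔ (K.liftingGerbe hG hH φ).IsClass 1 := fun φ => by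
    rw [CrossedModule.isClass_one_iff]
    constructor
    · rintro ⟨z, hz⟩
      induction z using Quotient.inductionOn with
      | h P => exact ⟨P, hz⟩
    · rintro ⟨P, hP⟩
      exact ⟨P.cls, hP⟩
  refine ⟨iA, iB, ⟨hone, fun Q R => hinj ?_⟩, ⟨rfl, fun _ _ => rfl⟩, ι, T, fun _ => rfl,
    fun _ => rfl, hinj, ?_, fun Q => ?_, CrossedModule.typeMap_eq_one_iff hG, hT, ?_⟩
  · rw [map_mul]
    exact (Quotient.sound (CrossedModule.extend_tensor Q R)).symm
  · ext z
    exact CrossedModule.exists_classExtend_eq_iff hG z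
  · refine ⟨fun h => ?_, fun h => ?_⟩
    · exact (Bibundle.isoSetoid K M).trans (CrossedModule.extend_congr h)
        CrossedModule.extend_trivial
    · exact CrossedModule.isIso_of_extend_isIso ((Bibundle.isoSetoid K M).trans h
        ((Bibundle.isoSetoid K M).symm CrossedModule.extend_trivial))
  · intro _ _
    -- The map ε is the class of one chosen set of lifting data for each φ. The choices for φ, φ'
    -- and φφ' are unrelated, so the product law needs independence of choices as well as
    -- `mul_cocycle`.
    choose U s g h using fun φ => CrossedModule.exists_liftData (M := M) hG hH φ
    have hε : ∀ φ c, (K.liftingGerbe hG hH φ).IsClass c ↔ c = Cech.H2.mk (h φ).cocycle := by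
      refine fun φ c => ⟨fun hc => ?_, ?_⟩
      · obtain ⟨_, _, _, h', rfl⟩ := CrossedModule.exists_liftData_of_isClass hc
        exact h'.mk_cocycle_eq hG (h φ)
      · rintro rfl
        exact (h φ).isClass hG hH
    refine ⟨fun φ => Cech.H2.mk (h φ).cocycle, hε, fun φ => ?_, fun φ φ' => ?_⟩
    · rw [hT, hε, eq_comm]
    · exact ((h (φ * φ')).mk_cocycle_eq hG ((h φ).mul (h φ'))).trans ((h φ).mul_cocycle (h φ'))
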